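/- Let $m\in\{0,1,2,\dots\}\cup\{\infty\}$ and let $g:\mathbb R^m\times\mathbb R^d\to\mathbb R$ and $\sigma:\mathbb R^m\times\mathbb R^d\to(0,\infty)$ be measurable. Let $\{y_t\}_{t\in\mathbb Z}$ and $\{\eta_t\}_{t\in\mathbb Z}$ be real random variables on a probability space with $$y_t=g(\mathbf Y_{t-1},\theta_0)+\sigma(\mathbf Y_{t-1},\theta_0)\eta_t\quad\text{a.s.},\qquad \mathbf Y_{t-1}=(y_{t-1},y_{t-2},\dots)\in\mathbb R^m,\qquad t\in\mathbb Z,$$ where $\theta_0\in\Theta\subseteq\mathbb R^d$ and $\eta_t$ is independent of $\{y_s:s<t\}$. Let $(\widetilde y_0,\widetilde y_{-1},\dots)$ be an initial value (constant or random), and for $t\ge1$ let $\widetilde{\mathbf Y}_{t-1}=(y_{t-1},\dots,y_1,\widetilde y_0,\widetilde y_{-1},\dots)$, truncated to its first $m$ entries. Write $g_t(\theta)=g(\mathbf Y_{t-1},\theta)$, $\sigma_t(\theta)=\sigma(\mathbf Y_{t-1},\theta)$, $\widetilde g_t(\theta)=g(\widetilde{\mathbf Y}_{t-1},\theta)$ and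 $\widetilde\sigma_t(\theta)=\sigma(\widetilde{\mathbf Y}_{t-1},\theta)$. Let $F(x)=1/(1+e^{-x})$ and $f(x)=e^{-x}/(1+e^{-x})^2$ be the standard logistic distribution function and density. Assume: 1. $\Theta$ is compact. 2. $\{\eta_t\}$ is i.i.d. and symmetric about $0$, with $\psi(\eta_t):=\mathbb E[\eta_t\{2F(\eta_t)-1\}]=1$. 3. $\{y_t\}$ is strictly stationary and ergodic. 4. There is a constant $\underline\sigma>0$ such that $\sigma_t(\theta)>\underline\sigma$ a.s. for every $\theta\in\Theta$ and every $t$. 5. For every $\mathbf Y\in\mathbb R^m$, $g(\mathbf Y,\cdot)$ and $\sigma(\mathbf Y,\cdot)$ are continuous on $\Theta$. 6. For every $t$ and every $\theta\in\Theta$, $(g_t(\theta),\sigma_t(\theta))=(g_t(\theta_0),\sigma_t(\theta_0))$ a.s. if and only if $\theta=\theta_0$. 7. There is $\iota>0$ such that $\mathbb E\sup_{\theta\in\Theta}|g_t(\theta)|^\iota+\mathbb E\,\sigma_t(\theta_0)^\iota<\infty$ for every $t$. 8. There are a nonnegative random variable $C_1$, not depending on $\theta$ and measurable with respect to the $\sigma$-algebra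 generated by $\{y_j:j\le0\}$, and a constant $\rho_1\in(0,1)$ such that $\sup_{\theta\in\Theta}\{|\widetilde g_t(\theta)-g_t(\theta)|+|\widetilde\sigma_t^2(\theta)-\sigma_t^2(\theta)|\}\le C_1\rho_1^t$ a.s. for all $t\ge1$. For each $n\ge1$ let $\widehat\theta_n$ be, almost surely, a maximizer over $\theta\in\Theta$ of the log logistic quasi-likelihood $$\widetilde{\mathcal L}_n(\theta)=\sum_{t=1}^n\left[-\log\widetilde\sigma_t(\theta)+\log f\!\left(\frac{y_t-\widetilde g_t(\theta)}{\widetilde\sigma_t(\theta)}\right)\right].$$ Then $\widehat\theta_n\to\theta_0$ almost surely as $n\to\infty$. -/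

import Mathlib

open MeasureTheory ProbabilityTheory Filter Topology

namespace LQMLE

noncomputable section

/-- Distribution function of the standard logistic distribution. -/
def logisticCDF (x : ℝ) : ℝ := 1 / (1 + Real.exp (-x))

/-- Density of the standard logistic distribution. -/
def logisticPDF (x : ℝ) : ℝ := Real.exp (-x) / (1 + Real.exp (-x)) ^ 2

/-- `h(x) = x {2F(x) - 1}`, with `F` the standard logistic distribution function. -/
def h (x : ℝ) : ℝ := x * (2 * logisticCDF x - 1)

/-- `ψ(X) = E h(X)`. As `h ≥ 0`, the equation `ψ(X) = 1` includes that `h(X)` is integrable. -/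
def psi {Ω : Type*} [MeasurableSpace Ω] (P : Measure Ω) (X : Ω → ℝ) : ℝ := ∫ ω, h (X ω) ∂P

/-- The lags `0, 1, …, m - 1` (all of `ℕ` if `m = ∞`). -/
abbrev Lag (m : ℕ∞) : Type := {j : ℕ // (j : ℕ∞) < m}

/-- The vector `(x_t, x_{t-1}, …)` of length `m ≤ ∞` of a path `x`. -/
def lagVector (m : ℕ∞) (x : ℤ → ℝ) (t : ℤ) : Lag m → ℝ := fun j => x (t - (j.1 : ℤ))

/-- The path that equals `y_s` at the observed times `s ≥ 1`, and the initial value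
`y0 k` at time `-k` for `k = 0, 1, 2, …`. -/
def observedPath (y : ℤ → ℝ) (y0 : ℕ → ℝ) : ℤ → ℝ :=
  fun s => if 1 ≤ s then y s else y0 (-s).toNat

/-- `-log σ(Y, θ) + log f((v - g(Y, θ)) / σ(Y, θ))`, with `f` the standard logistic density. -/
def ell {E Θ : Type*} (g σ : E → Θ → ℝ) (v : ℝ) (Y : E) (θ : Θ) : ℝ :=
  -Real.log (σ Y θ) + Real.log (logisticPDF ((v - g Y θ) / σ Y θ))

/-- The log logistic quasi-likelihood of `y_1, …, y_n`, computed with the initial value `y0`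
in the place of the unobserved past. -/
def quasiLogLik {Θ : Type*} (m : ℕ∞) (g σ : (Lag m → ℝ) → Θ → ℝ)
    (y : ℤ → ℝ) (y0 : ℕ → ℝ) (n : ℕ) (θ : Θ) : ℝ :=
  ∑ t ∈ Finset.Icc 1 n, ell g σ (y t) (lagVector m (observedPath y y0) ((t : ℤ) - 1)) θ

/-- The sigma-algebra generated by `y_j`, `j ≤ t`. -/
abbrev pastSigma {Ω : Type*} (y : ℤ → Ω → ℝ) (t : ℤ) : MeasurableSpace Ω :=
  ⨆ j : {j : ℤ // j ≤ t}, MeasurableSpace.comap (y j.1) inferInstance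

/-- The left shift on two-sided real sequences. -/
def shift (x : ℤ → ℝ) : ℤ → ℝ := fun t => x (t + 1)

/-- A process is strictly stationary and ergodic if the shift preserves its law on path space
and is ergodic for it (`Ergodic` includes measure preservation). -/
def IsStationaryErgodic {Ω : Type*} [MeasurableSpace Ω] (P : Measure Ω) (y : ℤ → Ω → ℝ) : Prop :=
  Ergodic shift (P.map (fun ω t => y t ω))

end

end LQMLE

/-! Write `φ = -log f` (`negLogPDF`); it is strictly convex, with derivative `2F - 1` (`score`) of
modulus at most 1. Let `e` be the innovation, `u = σ(θ₀)/σ(θ)` and `b = (g(θ) - g(θ₀))/σ(θ)`. The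
tangent of `φ` at `e` and `log u ≤ u - 1` bound the excess of `ell` at `θ` over `ell` at `θ₀` by `(u
- 1)(1 - h e) + b · score e` (`ell_sub_ell_le`), strictly unless the conditional mean and scale
agree at `θ` and `θ₀` (`ell_sub_ell_lt`). The condition `ψ = 1` centres `1 - h e`, symmetry centres
`score e`, and both are independent of the past, on which `u` and `b` depend. So the expected
criterion is uniquely largest at `θ₀`. The coefficients need not be integrable and the mean at `θ`
may be `-∞`; hence products are localized (`ae_eq_of_le_mul_add_mul`) and the inequality is stated
for truncations (`exists_integral_max_lt`).

The pointwise ergodic theorem `ae_tendsto_birkhoffAverage` and Wald's covering argument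
`ae_exists_nhds_eventually_birkhoffSum_add_le` turn this into a gap, locally uniform in the
parameter, between averages along almost every path.

The observed criterion starts from artificial initial values. The error `C ρ ^ t` meets factors with
finite fractional moments, which geometric weights annihilate (`ae_eventually_pow_mul_le`), so the
two criteria have averages that agree uniformly in the limit. By compactness, `tendsto_of_isMaxOn`
concludes. -/

namespace LQMLE

/-! ### Pointwise ergodic theorem through maximal sums. -/

section Birkhoff

variable {X : Type*} {T : X → X} {f : X → ℝ}

/-- The running maximum of `0` and the first `n` Birkhoff sums of `f`. -/
def maxBirkhoffSum (T : X → X) (f : X → ℝ) : ℕ → X → ℝ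
  | 0, _ => 0
  | n + 1, x => max 0 (f x + maxBirkhoffSum T f n (T x))

lemma maxBirkhoffSum_nonneg (n : ℕ) (x : X) : 0 ≤ maxBirkhoffSum T f n x := by
  cases n <;> simp [maxBirkhoffSum]

lemma maxBirkhoffSum_le_succ (n : ℕ) (x : X) :
    maxBirkhoffSum T f n x ≤ maxBirkhoffSum T f (n + 1) x := by
  induction n generalizing x with
  | zero => exact maxBirkhoffSum_nonneg 1 x
  | succ n ih =>
    simp only [maxBirkhoffSum]
    exact max_le_max le_rfl (add_le_add le_rfl (ih (T x)))

lemma birkhoffSum_le_maxBirkhoffSum (n : ℕ) (x : X) :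
    birkhoffSum T f n x ≤ maxBirkhoffSum T f n x := by
  induction n generalizing x with
  | zero => simp [maxBirkhoffSum]
  | succ n ih =>
    rw [birkhoffSum_succ']
    exact (add_le_add le_rfl (ih (T x))).trans (le_max_right _ _)

variable [MeasurableSpace X] {μ : Measure X}

lemma measurable_maxBirkhoffSum (hT : Measurable T) (hf : Measurable f) (n : ℕ) :
    Measurable (maxBirkhoffSum T f n) := by
  induction n with
  | zero => exact measurable_const
  | succ n ih => exact measurable_const.max (hf.add (ih.comp hT))

lemma integrable_maxBirkhoffSum (hT : MeasurePreserving T μ μ) (hi : Integrable f μ) (n : ℕ) :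
    Integrable (maxBirkhoffSum T f n) μ := by
  induction n with
  | zero => exact integrable_zero _ _ _
  | succ n ih =>
    exact (integrable_zero _ _ _).sup (hi.add (hT.integrable_comp_of_integrable ih))

/-- The set where the running maxima `M n` are unbounded is invariant, hence null or full. If it
were full, `M (n + 1) - M n ∘ T` would tend to `f`, dominated by `|f|`; its integral is `∫ (M (n +
1) - M n) ≥ 0` by invariance of `μ`, against `∫ f < 0`. -/
lemma ae_bddAbove_birkhoffSum (hT : Ergodic T μ) (hf : Measurable f) (hi : Integrable f μ)
    (hneg : ∫ x, f x ∂μ < 0) :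
    ∀ᵐ x ∂μ, ∃ B, ∀ n, birkhoffSum T f n x ≤ B := by
  set M := maxBirkhoffSum T f with hM
  have hMm : ∀ n, Measurable (M n) := measurable_maxBirkhoffSum hT.measurable hf
  have hMi : ∀ n, Integrable (M n) μ := integrable_maxBirkhoffSum hT.toMeasurePreserving hi
  let A : Set X := {x | ∀ K : ℕ, ∃ n, (K : ℝ) < M n x}
  have hA : MeasurableSet A := by
    have : A = ⋂ K : ℕ, ⋃ n, {x | (K : ℝ) < M n x} := by ext; simp [A]
    rw [this]
    exact MeasurableSet.iInter fun K => MeasurableSet.iUnion fun n =>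
      measurableSet_lt measurable_const (hMm n)
  have hinv : T ⁻¹' A = A := by
    ext x
    constructor
    · intro hx K
      obtain ⟨K', hK'⟩ := exists_nat_gt ((K : ℝ) - f x)
      obtain ⟨n, hn⟩ := hx K'
      exact ⟨n + 1, lt_of_lt_of_le (by linarith) (le_max_right _ _)⟩
    · intro hx K
      obtain ⟨K', hK'⟩ := exists_nat_gt (max 0 (f x + K))
      obtain ⟨n, hn⟩ := hx K'
      have h0 : 0 < K' := by exact_mod_cast (le_max_left _ _).trans_lt hK'
      cases n with
      | zero =>
        simp only [hM, maxBirkhoffSum] at hn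
        exact absurd hn (not_lt.2 (Nat.cast_nonneg K'))
      | succ n =>
        refine ⟨n, ?_⟩
        have h1 : f x + K < K' := (le_max_right _ _).trans_lt hK'
        have h2 : (0 : ℝ) < K' := by exact_mod_cast h0
        change (K' : ℝ) < max 0 (f x + M n (T x)) at hn
        rcases lt_max_iff.1 hn with h | h <;> linarith
  rcases hT.toPreErgodic.ae_empty_or_univ hA hinv with h | h
  · filter_upwards [h] with x hx
    have : ¬ x ∈ A := fun hxA => by
      have : x ∈ (∅ : Set X) := by
        have := hx.mp hxA
        exact this
      exact this
    simp only [A, Set.mem_ofPred_eq, not_forall, not_exists, not_lt] at this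
    obtain ⟨K, hK⟩ := this
    exact ⟨K, fun n => (birkhoffSum_le_maxBirkhoffSum n x).trans (hK n)⟩
  · exfalso
    have hTA : ∀ᵐ x ∂μ, Tendsto (fun n => M n (T x)) atTop atTop := by
      filter_upwards [h] with x hx
      have hxA : T x ∈ A := by
        have : x ∈ T ⁻¹' A := hinv.symm ▸ hx.mpr trivial
        exact this
      refine tendsto_atTop_atTop_of_monotone
        (monotone_nat_of_le_succ fun n => maxBirkhoffSum_le_succ n (T x)) fun b => ?_
      obtain ⟨K, hK⟩ := exists_nat_gt b
      obtain ⟨n, hn⟩ := hxA K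
      exact ⟨n, (hK.trans hn).le⟩
    have hlim : Tendsto (fun n => ∫ x, (M (n + 1) x - M n (T x)) ∂μ) atTop (𝓝 (∫ x, f x ∂μ)) := by
      refine tendsto_integral_of_dominated_convergence (fun x => |f x|)
        (fun n => ((hMm _).sub ((hMm n).comp hT.measurable)).aestronglyMeasurable) hi.abs ?_ ?_
      · intro n
        refine Eventually.of_forall fun x => ?_
        have h0 : 0 ≤ M n (T x) := maxBirkhoffSum_nonneg n (T x)
        change |max 0 (f x + M n (T x)) - M n (T x)| ≤ |f x|
        rcases max_cases 0 (f x + M n (T x)) with ⟨h1, h2⟩ | ⟨h1, h2⟩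
        · rw [h1, abs_le]
          have := neg_abs_le (f x)
          have := abs_nonneg (f x)
          constructor <;> linarith
        · rw [h1]; simp
      · filter_upwards [hTA] with x hx
        refine tendsto_const_nhds.congr' ?_
        filter_upwards [hx.eventually_ge_atTop (-f x)] with n hn
        change f x = max 0 (f x + M n (T x)) - M n (T x)
        rw [max_eq_right (by linarith)]; ring
    have hpos : ∀ n, 0 ≤ ∫ x, (M (n + 1) x - M n (T x)) ∂μ := by
      intro n
      have hc : ∫ x, M n (T x) ∂μ = ∫ x, M n x ∂μ := by
        rw [← integral_map hT.measurable.aemeasurable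
          (hMm n).aestronglyMeasurable, hT.toMeasurePreserving.map_eq]
      have hTi : Integrable (fun x => M n (T x)) μ :=
        hT.toMeasurePreserving.integrable_comp_of_integrable (hMi n)
      rw [integral_sub (hMi _) hTi, hc, sub_nonneg]
      exact integral_mono (hMi _) (hMi _) fun x => maxBirkhoffSum_le_succ n x
    exact absurd (ge_of_tendsto' hlim hpos) (not_le.2 hneg)

/-- For `∫ f < b < c` the Birkhoff sums of `f - b` are bounded above, and `n (c - b)` eventually
absorbs the bound. -/
lemma ae_eventually_birkhoffSum_le [IsProbabilityMeasure μ] (hT : Ergodic T μ) (hf : Measurable f)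
    (hi : Integrable f μ) {c : ℝ} (hc : ∫ x, f x ∂μ < c) :
    ∀ᵐ x ∂μ, ∀ᶠ n : ℕ in atTop, birkhoffSum T f n x ≤ n * c := by
  obtain ⟨b, hb, hbc⟩ := exists_between hc
  have h := ae_bddAbove_birkhoffSum hT (f := fun x => f x - b) (hf.sub_const b)
    (hi.sub (integrable_const b)) (by
      rw [integral_sub hi (integrable_const b)]; simpa using hb)
  filter_upwards [h] with x ⟨B, hB⟩
  obtain ⟨N, hN⟩ := exists_nat_gt (B / (c - b))
  filter_upwards [eventually_ge_atTop N] with n hn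
  have h1 := hB n
  have h2 : birkhoffSum T (fun x => f x - b) n x = birkhoffSum T f n x - n * b := by
    simp [birkhoffSum]
  rw [h2] at h1
  rw [div_lt_iff₀ (by linarith)] at hN
  have h3 : (N : ℝ) ≤ n := by exact_mod_cast hn
  nlinarith

/-- **Birkhoff's pointwise ergodic theorem** for an ergodic probability-preserving map. -/
theorem ae_tendsto_birkhoffAverage [IsProbabilityMeasure μ] (hT : Ergodic T μ) (hf : Measurable f)
    (hi : Integrable f μ) :
    ∀ᵐ x ∂μ, Tendsto (fun n : ℕ => (n : ℝ)⁻¹ * birkhoffSum T f n x) atTop (𝓝 (∫ x, f x ∂μ)) := by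
  have h1 : ∀ k : ℕ, ∀ᵐ x ∂μ, ∀ᶠ n : ℕ in atTop,
      birkhoffSum T f n x ≤ n * (∫ x, f x ∂μ + 1 / ((k : ℝ) + 1)) := fun k =>
    ae_eventually_birkhoffSum_le hT hf hi (lt_add_of_pos_right _ Nat.one_div_pos_of_nat)
  have h2 : ∀ k : ℕ, ∀ᵐ x ∂μ, ∀ᶠ n : ℕ in atTop,
      birkhoffSum T (-f) n x ≤ n * (-∫ x, f x ∂μ + 1 / ((k : ℝ) + 1)) := fun k =>
    ae_eventually_birkhoffSum_le hT hf.neg hi.neg (by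
      simp only [Pi.neg_apply, integral_neg]
      exact lt_add_of_pos_right _ Nat.one_div_pos_of_nat)
  filter_upwards [ae_all_iff.2 h1, ae_all_iff.2 h2] with x hx1 hx2
  rw [Metric.tendsto_atTop']
  intro ε hε
  obtain ⟨k, hk⟩ := exists_nat_one_div_lt hε
  obtain ⟨N, hN⟩ := eventually_atTop.1 ((hx1 k).and (hx2 k))
  refine ⟨N, fun n hn => ?_⟩
  obtain ⟨ha, hb⟩ := hN n hn.le
  have h3 : birkhoffSum T (-f) n x = -birkhoffSum T f n x := by simp [birkhoffSum]
  rw [h3] at hb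
  have hn0 : (0 : ℝ) < n := by exact_mod_cast (Nat.zero_le N).trans_lt hn
  rw [Real.dist_eq, abs_lt, inv_mul_eq_div]
  constructor
  · have : ∫ x, f x ∂μ - 1 / ((k : ℝ) + 1) ≤ birkhoffSum T f n x / n := by
      rw [le_div_iff₀ hn0]; nlinarith
    linarith
  · have : birkhoffSum T f n x / n ≤ ∫ x, f x ∂μ + 1 / ((k : ℝ) + 1) := by
      rw [div_le_iff₀ hn0]; nlinarith
    linarith

end Birkhoff

/-! ### Convexity of the logistic loss and the pointwise likelihood comparison. -/

section Logistic

/-- `-log f`, with `f` the standard logistic density. -/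
noncomputable def negLogPDF (x : ℝ) : ℝ := x + 2 * Real.log (1 + Real.exp (-x))

/-- The derivative `2 F - 1` of `-log f`, with `F` the standard logistic distribution function. -/
noncomputable def score (x : ℝ) : ℝ := 2 * logisticCDF x - 1

lemma log_logisticPDF (x : ℝ) : Real.log (logisticPDF x) = -negLogPDF x := by
  have : 0 < 1 + Real.exp (-x) := by positivity
  rw [logisticPDF, Real.log_div (by positivity) (by positivity), Real.log_exp, Real.log_pow,
    negLogPDF]
  push_cast; ring

lemma h_eq_mul_score (x : ℝ) : h x = x * score x := rfl

lemma measurable_negLogPDF : Measurable negLogPDF := by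
  unfold negLogPDF; fun_prop

lemma continuous_negLogPDF : Continuous negLogPDF := by
  unfold negLogPDF
  refine continuous_id.add (continuous_const.mul (Continuous.log (by fun_prop) fun x => ?_))
  positivity

lemma measurable_score : Measurable score := by
  unfold score logisticCDF; fun_prop

lemma abs_score_le_one (x : ℝ) : |score x| ≤ 1 := by
  have he := Real.exp_pos (-x)
  have h1 : 0 < 1 / (1 + Real.exp (-x)) := by positivity
  have h2 : 1 / (1 + Real.exp (-x)) ≤ 1 := by rw [div_le_one (by positivity)]; linarith
  rw [score, logisticCDF, abs_le]; constructor <;> linarith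

lemma score_neg (x : ℝ) : score (-x) = -score x := by
  have he := Real.exp_pos x
  rw [score, score, logisticCDF, logisticCDF, neg_neg, Real.exp_neg]
  field_simp; ring

lemma negLogPDF_nonneg (x : ℝ) : 0 ≤ negLogPDF x := by
  have he := Real.exp_pos (-x)
  have h1 : Real.log (Real.exp (-x)) ≤ Real.log ((1 + Real.exp (-x)) ^ 2) :=
    Real.log_le_log he (by nlinarith)
  rw [Real.log_exp, Real.log_pow] at h1
  push_cast at h1
  rw [negLogPDF]; linarith

/-- Strict convexity of `-log f`: its graph lies strictly above each tangent. -/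
lemma tangent_lt_negLogPDF {x v : ℝ} (hxv : v ≠ x) :
    negLogPDF x + score x * (v - x) < negLogPDF v := by
  set p : ℝ := Real.exp (-x) / (1 + Real.exp (-x)) with hp
  have hex := Real.exp_pos (-x)
  have hp0 : 0 < p := by positivity
  have hp1 : 0 < 1 - p := by
    rw [hp, sub_pos, div_lt_one (by positivity)]; linarith
  have hs : score x = 1 - 2 * p := by
    rw [score, logisticCDF, hp]; field_simp; ring
  -- With `p = 1 - F(x)`, the mean of `exp` at `0` and `x - v` with weights `1 - p` and `p` is the
  -- ratio of `1 + exp (-v)` to `1 + exp (-x)`; taking logarithms gives the tangent inequality.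
  have hconv := strictConvexOn_exp.2 (Set.mem_univ (0 : ℝ)) (Set.mem_univ (x - v))
    (fun h => hxv (by linarith)) hp1 hp0 (by ring)
  simp only [smul_eq_mul, mul_zero, zero_add, Real.exp_zero, mul_one] at hconv
  have hid : 1 - p + p * Real.exp (x - v) = (1 + Real.exp (-v)) / (1 + Real.exp (-x)) := by
    have : Real.exp (-v) = Real.exp (-x) * Real.exp (x - v) := by
      rw [← Real.exp_add]; ring_nf
    rw [this, hp]; field_simp; ring
  rw [hid] at hconv
  have hlog := Real.log_lt_log (Real.exp_pos _) hconv
  rw [Real.log_exp, Real.log_div (by positivity) (by positivity)] at hlog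
  rw [negLogPDF, negLogPDF, hs]
  nlinarith

lemma tangent_le_negLogPDF (x v : ℝ) : negLogPDF x + score x * (v - x) ≤ negLogPDF v := by
  rcases eq_or_ne v x with rfl | hne
  · simp
  · exact (tangent_lt_negLogPDF hne).le

lemma negLogPDF_sub_le (x v : ℝ) : negLogPDF x - negLogPDF v ≤ |x - v| := by
  have h1 := tangent_le_negLogPDF x v
  have h2 : score x * (x - v) ≤ |x - v| := by
    refine (le_abs_self _).trans ?_
    rw [abs_mul]
    exact mul_le_of_le_one_left (abs_nonneg _) (abs_score_le_one x)
  nlinarith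

lemma abs_negLogPDF_sub_le (x v : ℝ) : |negLogPDF x - negLogPDF v| ≤ |x - v| := by
  rw [abs_le]
  have h1 := negLogPDF_sub_le x v
  have h2 := negLogPDF_sub_le v x
  rw [abs_sub_comm] at h2
  constructor <;> linarith

/-- For `x ≥ 0`, `x - h x = 2 x exp (-x) / (1 + exp (-x))` stays bounded, and `h` is even. This
makes the innovation integrable once `h` of it is. -/
lemma abs_le_h_add_two (x : ℝ) : |x| ≤ h x + 2 := by
  have key : ∀ z : ℝ, 0 ≤ z → z ≤ h z + 2 := by
    intro z hz
    have he := Real.exp_pos (-z)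
    have h1 : z * Real.exp (-z) ≤ 1 := by
      rw [Real.exp_neg, ← div_eq_mul_inv, div_le_one (Real.exp_pos z)]
      linarith [Real.add_one_le_exp z]
    have h2 : z - h z = 2 * (z * Real.exp (-z)) / (1 + Real.exp (-z)) := by
      rw [h, logisticCDF]; field_simp; ring
    have h3 : 2 * (z * Real.exp (-z)) / (1 + Real.exp (-z)) ≤ 2 := by
      rw [div_le_iff₀ (by positivity)]; nlinarith
    linarith
  rcases le_total 0 x with hx | hx
  · rw [abs_of_nonneg hx]; exact key x hx
  · have h1 := key (-x) (by linarith)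
    rw [h_eq_mul_score, score_neg] at h1
    rw [abs_of_nonpos hx, h_eq_mul_score]
    linarith

variable {E K : Type*} {g σ : E → K → ℝ}

lemma ell_eq (v : ℝ) (Y : E) (θ : K) :
    ell g σ v Y θ = -Real.log (σ Y θ) - negLogPDF ((v - g Y θ) / σ Y θ) := by
  rw [ell, log_logisticPDF]; ring

lemma ell_le {c : ℝ} (hc : 0 < c) {Y : E} {θ : K} (hσ : c ≤ σ Y θ) (v : ℝ) :
    ell g σ v Y θ ≤ -Real.log c := by
  rw [ell_eq]
  have := Real.log_le_log hc hσ
  have := negLogPDF_nonneg ((v - g Y θ) / σ Y θ)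
  linarith

/-- The excess of `ell` at `θ` over `ell` at `θ₀` is dominated by a linear expression in functions
of the innovation, with coefficients that depend on the past only. -/
lemma ell_sub_ell_le {Y : E} {θ θ₀ : K} (h1 : 0 < σ Y θ) (h0 : 0 < σ Y θ₀) (e : ℝ) :
    ell g σ (g Y θ₀ + σ Y θ₀ * e) Y θ - ell g σ (g Y θ₀ + σ Y θ₀ * e) Y θ₀ ≤
      (σ Y θ₀ / σ Y θ - 1) * (1 - h e) + (g Y θ - g Y θ₀) / σ Y θ * score e := by
  rw [ell_eq, ell_eq, add_sub_cancel_left, mul_div_cancel_left₀ _ h0.ne']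
  have ht := tangent_le_negLogPDF e ((g Y θ₀ + σ Y θ₀ * e - g Y θ) / σ Y θ)
  have hl := Real.log_le_sub_one_of_pos (div_pos h0 h1)
  rw [Real.log_div h0.ne' h1.ne'] at hl
  have hv : (g Y θ₀ + σ Y θ₀ * e - g Y θ) / σ Y θ - e =
      (σ Y θ₀ / σ Y θ - 1) * e - (g Y θ - g Y θ₀) / σ Y θ := by
    field_simp; ring
  rw [hv] at ht
  rw [h_eq_mul_score]
  nlinarith

/-- Unequal scales make `log u ≤ u - 1` strict. Equal scales with unequal means move the
standardized residual away from `e`, so the tangent inequality is strict. -/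
lemma ell_sub_ell_lt {Y : E} {θ θ₀ : K} (h1 : 0 < σ Y θ) (h0 : 0 < σ Y θ₀) (e : ℝ)
    (hne : (g Y θ, σ Y θ) ≠ (g Y θ₀, σ Y θ₀)) :
    ell g σ (g Y θ₀ + σ Y θ₀ * e) Y θ - ell g σ (g Y θ₀ + σ Y θ₀ * e) Y θ₀ <
      (σ Y θ₀ / σ Y θ - 1) * (1 - h e) + (g Y θ - g Y θ₀) / σ Y θ * score e := by
  rw [ell_eq, ell_eq, add_sub_cancel_left, mul_div_cancel_left₀ _ h0.ne']
  have ht := tangent_le_negLogPDF e ((g Y θ₀ + σ Y θ₀ * e - g Y θ) / σ Y θ)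
  have hl := Real.log_le_sub_one_of_pos (div_pos h0 h1)
  rw [Real.log_div h0.ne' h1.ne'] at hl
  have hv : (g Y θ₀ + σ Y θ₀ * e - g Y θ) / σ Y θ - e =
      (σ Y θ₀ / σ Y θ - 1) * e - (g Y θ - g Y θ₀) / σ Y θ := by
    field_simp; ring
  rw [h_eq_mul_score]
  by_cases hσ : σ Y θ₀ = σ Y θ
  · have hg : g Y θ - g Y θ₀ ≠ 0 := fun hg => hne (by rw [sub_eq_zero.1 hg, hσ])
    have hne' : (g Y θ₀ + σ Y θ₀ * e - g Y θ) / σ Y θ ≠ e := by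
      rw [← sub_ne_zero, hv, hσ, div_self h1.ne', sub_self, zero_mul, zero_sub, neg_ne_zero]
      exact div_ne_zero hg h1.ne'
    have ht' := tangent_lt_negLogPDF hne'
    rw [hv] at ht'
    nlinarith
  · have hu : σ Y θ₀ / σ Y θ ≠ 1 := fun hu => hσ ((div_eq_one_iff_eq h1.ne').1 hu)
    have hl' := Real.log_lt_sub_one_of_pos (div_pos h0 h1) hu
    rw [Real.log_div h0.ne' h1.ne'] at hl'
    rw [hv] at ht
    nlinarith

end Logistic

/-! ### Strict comparison of means without integrable coefficients. -/

section Identification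

variable {Ω : Type*} [MeasurableSpace Ω] {P : Measure Ω}

/-- If the integrals of the truncations of an essentially bounded above function from below are
bounded from below, then so is the integral of the function. -/
lemma integrable_of_le_integral_max [IsProbabilityMeasure P] {A : Ω → ℝ} (hA : Measurable A) {B a : ℝ}
    (hB : ∀ᵐ ω ∂P, A ω ≤ B) (ha : ∀ n : ℕ, a ≤ ∫ ω, max (A ω) (-(n : ℝ)) ∂P) :
    Integrable A P ∧ a ≤ ∫ ω, A ω ∂P := by
  have hmi : ∀ n : ℕ, Integrable (fun ω => max (A ω) (-(n : ℝ))) P := by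
    intro n
    refine Integrable.of_bound (hA.max measurable_const).aestronglyMeasurable (|B| + n) ?_
    filter_upwards [hB] with ω hω
    have hn : (0 : ℝ) ≤ n := Nat.cast_nonneg n
    have := le_abs_self B
    have := abs_nonneg B
    rw [Real.norm_eq_abs, abs_le]
    constructor
    · exact le_trans (by linarith) (le_max_right _ _)
    · exact max_le (by linarith) (by linarith)
  have hpt : ∀ x : ℝ, Tendsto (fun n : ℕ => max x (-(n : ℝ))) atTop (𝓝 x) := by
    intro x
    refine tendsto_const_nhds.congr' ?_
    obtain ⟨N, hN⟩ := exists_nat_gt (-x)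
    filter_upwards [eventually_ge_atTop N] with n hn
    have : (N : ℝ) ≤ n := by exact_mod_cast hn
    rw [max_eq_left (by linarith)]
  have hanti : ∀ x : ℝ, Antitone (fun n : ℕ => max x (-(n : ℝ))) := by
    intro x n k hnk
    have : (n : ℝ) ≤ k := by exact_mod_cast hnk
    exact max_le_max le_rfl (by linarith)
  -- Monotone convergence for `max B 0 - max A (-n)`. Using `max B 0` instead of `B` keeps this
  -- nonnegative for every `n`, even if `B < -n`.
  have hint : Integrable (fun ω => max B 0 - A ω) P := by
    have hlim := lintegral_tendsto_of_tendsto_of_monotone (μ := P)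
      (f := fun (n : ℕ) ω => ENNReal.ofReal (max B 0 - max (A ω) (-(n : ℝ))))
      (F := fun ω => ENNReal.ofReal (max B 0 - A ω))
      (fun n => (measurable_const.sub (hA.max measurable_const)).ennreal_ofReal.aemeasurable)
      (Eventually.of_forall fun ω n k hnk =>
        ENNReal.ofReal_le_ofReal (sub_le_sub_left (hanti (A ω) hnk) _))
      (Eventually.of_forall fun ω => ENNReal.tendsto_ofReal (tendsto_const_nhds.sub (hpt (A ω))))
    have hle : ∀ n : ℕ, ∫⁻ ω, ENNReal.ofReal (max B 0 - max (A ω) (-(n : ℝ))) ∂P ≤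
        ENNReal.ofReal (max B 0 - a) := by
      intro n
      have hi : Integrable (fun ω => max B 0 - max (A ω) (-(n : ℝ))) P :=
        (integrable_const _).sub (hmi n)
      rw [← ofReal_integral_eq_lintegral_ofReal hi]
      · rw [integral_sub (integrable_const _) (hmi n)]
        refine ENNReal.ofReal_le_ofReal ?_
        have := ha n
        rw [integral_const, probReal_univ, one_smul]
        linarith
      · filter_upwards [hB] with ω hω
        simp only [Pi.zero_apply, sub_nonneg]
        refine max_le (hω.trans (le_max_left _ _)) ?_
        exact (neg_nonpos.2 (Nat.cast_nonneg n)).trans (le_max_right _ _)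
    have hfin := (le_of_tendsto' hlim hle).trans_lt ENNReal.ofReal_lt_top
    refine (lintegral_ofReal_ne_top_iff_integrable
      (measurable_const.sub hA).aestronglyMeasurable ?_).1 hfin.ne
    filter_upwards [hB] with ω hω
    exact sub_nonneg.2 (hω.trans (le_max_left _ _))
  have hAi : Integrable A P := by
    have := (integrable_const (max B 0)).sub hint
    refine this.congr (Eventually.of_forall fun ω => ?_)
    simp
  refine ⟨hAi, ge_of_tendsto' (integral_tendsto_of_tendsto_of_antitone hmi hAi
    (Eventually.of_forall fun ω => hanti (A ω)) (Eventually.of_forall fun ω => hpt (A ω))) ha⟩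

/-- Equality case of the comparison with a generalized martingale difference: if `D ≤ u X + b Z`, with `X` and `Z` centred and independent of `(u, b)`, and `D` has a
nonnegative mean, then `D = u X + b Z`. -/
lemma ae_eq_of_le_mul_add_mul {D u b X Z : Ω → ℝ} (hu : Measurable u) (hb : Measurable b)
    (hX : Integrable X P) (hZ : Integrable Z P)
    (hX0 : ∫ ω, X ω ∂P = 0) (hZ0 : ∫ ω, Z ω ∂P = 0)
    (hiX : IndepFun (fun ω => (u ω, b ω)) X P) (hiZ : IndepFun (fun ω => (u ω, b ω)) Z P)
    (hle : ∀ᵐ ω ∂P, D ω ≤ u ω * X ω + b ω * Z ω) (hD : Integrable D P)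
    (hD0 : 0 ≤ ∫ ω, D ω ∂P) :
    ∀ᵐ ω ∂P, D ω = u ω * X ω + b ω * Z ω := by
  -- Localization: `S K` depends on `(u, b)` only, so restricting to it makes the coefficients
  -- bounded and preserves independence from `X` and `Z`.
  let S : ℕ → Set Ω := fun K => {ω | |u ω| ≤ K ∧ |b ω| ≤ K}
  have hS : ∀ K, MeasurableSet (S K) := fun K =>
    (measurableSet_le hu.abs measurable_const).inter (measurableSet_le hb.abs measurable_const)
  have hprod : ∀ (K : ℕ) (w V : Ω → ℝ) (φ : ℝ × ℝ → ℝ), Measurable φ →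
      (∀ ω, w ω = φ (u ω, b ω)) → (∀ ω ∈ S K, |w ω| ≤ K) → Integrable V P →
      ∫ ω, V ω ∂P = 0 → IndepFun (fun ω => (u ω, b ω)) V P →
      Integrable (fun ω => (S K).indicator w ω * V ω) P ∧
        ∫ ω, (S K).indicator w ω * V ω ∂P = 0 := by
    intro K w V φ hφ hw hwK hV hV0 hi
    have hwm : Measurable w := by
      have : w = fun ω => φ (u ω, b ω) := funext hw
      rw [this]; exact hφ.comp (hu.prodMk hb)
    have hφS : MeasurableSet {p : ℝ × ℝ | |p.1| ≤ K ∧ |p.2| ≤ K} :=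
      (measurableSet_le measurable_fst.abs measurable_const).inter
        (measurableSet_le measurable_snd.abs measurable_const)
    have hcomp : (S K).indicator w =
        ({p : ℝ × ℝ | |p.1| ≤ K ∧ |p.2| ≤ K}.indicator φ) ∘ fun ω => (u ω, b ω) := by
      funext ω
      by_cases hω : |u ω| ≤ K ∧ |b ω| ≤ K
      · simp [Set.indicator, S, hω, hw]
      · simp [Set.indicator, S, hω]
    refine ⟨hV.bdd_mul (c := K) (hwm.indicator (hS K)).aestronglyMeasurable ?_, ?_⟩
    · refine Eventually.of_forall fun ω => ?_
      by_cases hω : ω ∈ S K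
      · rw [Set.indicator_of_mem hω]; exact hwK ω hω
      · rw [Set.indicator_of_notMem hω]; simp
    · have hind : IndepFun ((S K).indicator w) V P := by
        rw [hcomp]
        exact hi.comp (hφ.indicator hφS) measurable_id
      rw [hind.integral_fun_mul_eq_mul_integral
        (hwm.indicator (hS K)).aestronglyMeasurable hV.aestronglyMeasurable, hV0, mul_zero]
  have hprodu := fun K => hprod K u X Prod.fst measurable_fst (fun _ => rfl) (fun ω hω => hω.1)
    hX hX0 hiX
  have hprodb := fun K => hprod K b Z Prod.snd measurable_snd (fun _ => rfl) (fun ω hω => hω.2)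
    hZ hZ0 hiZ
  set V : Ω → ℝ := fun ω => u ω * X ω + b ω * Z ω - D ω with hV
  have hV0 : ∀ᵐ ω ∂P, 0 ≤ V ω := by
    filter_upwards [hle] with ω hω using sub_nonneg.2 hω
  have hVeq : ∀ K, (S K).indicator V = fun ω =>
      (S K).indicator u ω * X ω + (S K).indicator b ω * Z ω - (S K).indicator D ω := by
    intro K; funext ω
    by_cases hω : ω ∈ S K
    · simp [hω, hV]
    · simp [hω]
  have hVi : ∀ K, Integrable ((S K).indicator V) P := by
    intro K
    rw [hVeq]
    exact ((hprodu K).1.add (hprodb K).1).sub (hD.indicator (hS K))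
  have hVint : ∀ K, ∫ ω, (S K).indicator V ω ∂P = -∫ ω, (S K).indicator D ω ∂P := by
    intro K
    have h1 : Integrable (fun ω => (S K).indicator u ω * X ω + (S K).indicator b ω * Z ω) P :=
      (hprodu K).1.add (hprodb K).1
    have h2 : ∫ ω, (S K).indicator V ω ∂P = ∫ ω, ((S K).indicator u ω * X ω +
        (S K).indicator b ω * Z ω - (S K).indicator D ω) ∂P := by rw [hVeq]
    rw [h2, integral_sub h1 (hD.indicator (hS K)),
      integral_add (hprodu K).1 (hprodb K).1, (hprodu K).2, (hprodb K).2]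
    simp
  have hmem : ∀ ω, ∀ᶠ K : ℕ in atTop, ω ∈ S K := by
    intro ω
    obtain ⟨N, hN⟩ := exists_nat_gt (max |u ω| |b ω|)
    filter_upwards [eventually_ge_atTop N] with n hn
    have : (N : ℝ) ≤ n := by exact_mod_cast hn
    exact ⟨((le_max_left _ _).trans hN.le).trans this, ((le_max_right _ _).trans hN.le).trans this⟩
  have hlimD : Tendsto (fun K => ∫ ω, (S K).indicator D ω ∂P) atTop (𝓝 (∫ ω, D ω ∂P)) := by
    refine tendsto_integral_of_dominated_convergence (fun ω => |D ω|)
      (fun K => (hD.indicator (hS K)).aestronglyMeasurable) hD.abs ?_ ?_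
    · intro K
      refine Eventually.of_forall fun ω => ?_
      by_cases hω : ω ∈ S K <;> simp [hω]
    · refine Eventually.of_forall fun ω => ?_
      refine tendsto_const_nhds.congr' ?_
      filter_upwards [hmem ω] with K hK
      rw [Set.indicator_of_mem hK]
  have hmono : Monotone fun K => ∫ ω, (S K).indicator V ω ∂P := by
    intro K L hKL
    refine integral_mono_ae (hVi K) (hVi L) ?_
    filter_upwards [hV0] with ω hω
    have hc : (K : ℝ) ≤ L := by exact_mod_cast hKL
    by_cases hK : ω ∈ S K
    · have hL : ω ∈ S L := ⟨hK.1.trans hc, hK.2.trans hc⟩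
      rw [Set.indicator_of_mem hK, Set.indicator_of_mem hL]
    · rw [Set.indicator_of_notMem hK]
      exact Set.indicator_apply_nonneg fun _ => hω
  have hzero : ∀ K, (S K).indicator V =ᵐ[P] 0 := by
    intro K
    have hnn : 0 ≤ᵐ[P] (S K).indicator V := by
      filter_upwards [hV0] with ω hω
      exact Set.indicator_apply_nonneg fun _ => hω
    rw [← integral_eq_zero_iff_of_nonneg_ae hnn (hVi K)]
    refine le_antisymm ?_ (integral_nonneg_of_ae hnn)
    -- The localized integrals of `V ≥ 0` increase to `-∫ D ≤ 0`, so each of them vanishes.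
    have hlim : Tendsto (fun K => ∫ ω, (S K).indicator V ω ∂P) atTop (𝓝 (-∫ ω, D ω ∂P)) := by
      simp only [hVint]; exact hlimD.neg
    exact (hmono.ge_of_tendsto hlim K).trans (by linarith)
  filter_upwards [ae_all_iff.2 hzero] with ω hω
  obtain ⟨K, hK⟩ := (hmem ω).exists
  have := hω K
  rw [Set.indicator_of_mem hK] at this
  simp only [hV, Pi.zero_apply] at this
  linarith

/-- If `A - A₀` is dominated, not almost surely with equality, by a generalized martingale
difference, then some truncation of `A` has a smaller mean than `A₀`. -/
lemma exists_integral_max_lt [IsProbabilityMeasure P] {A A₀ u b X Z : Ω → ℝ} (hA : Measurable A) (hA₀ : Integrable A₀ P)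
    {B : ℝ} (hB : ∀ᵐ ω ∂P, A ω ≤ B) (hu : Measurable u) (hb : Measurable b)
    (hX : Integrable X P) (hZ : Integrable Z P)
    (hX0 : ∫ ω, X ω ∂P = 0) (hZ0 : ∫ ω, Z ω ∂P = 0)
    (hiX : IndepFun (fun ω => (u ω, b ω)) X P) (hiZ : IndepFun (fun ω => (u ω, b ω)) Z P)
    (hle : ∀ᵐ ω ∂P, A ω - A₀ ω ≤ u ω * X ω + b ω * Z ω)
    (hne : ¬ ∀ᵐ ω ∂P, A ω - A₀ ω = u ω * X ω + b ω * Z ω) :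
    ∃ n : ℕ, ∫ ω, max (A ω) (-(n : ℝ)) ∂P < ∫ ω, A₀ ω ∂P := by
  by_contra hcon
  simp only [not_exists, not_lt] at hcon
  obtain ⟨hAi, hAint⟩ := integrable_of_le_integral_max hA hB hcon
  refine hne (ae_eq_of_le_mul_add_mul hu hb hX hZ hX0 hZ0 hiX hiZ hle (hAi.sub hA₀) ?_)
  rw [integral_sub hAi hA₀]
  linarith

end Identification

/-! ### Wald's local domination and countable covering. -/

section Wald

variable {X : Type*} [MeasurableSpace X] {μ : Measure X} [IsProbabilityMeasure μ]
  {K : Type*} [PseudoMetricSpace K] [SecondCountableTopology K]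

/-- A bounded random continuous function is dominated near each point by a random variable
whose mean is close to the mean at that point. -/
lemma exists_nhds_integral_lt {F : X → K → ℝ} (hFm : ∀ θ, Measurable fun x => F x θ)
    (hFc : ∀ x, Continuous (F x)) {B : ℝ} (hB : ∀ x θ, |F x θ| ≤ B) (θ₁ : K) {c : ℝ}
    (hc : ∫ x, F x θ₁ ∂μ < c) :
    ∃ V : Set K, IsOpen V ∧ θ₁ ∈ V ∧ ∃ W : X → ℝ, Measurable W ∧ Integrable W μ ∧
      (∀ x, ∀ θ ∈ V, F x θ ≤ W x) ∧ ∫ x, W x ∂μ < c := by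
  have : Nonempty K := ⟨θ₁⟩
  let s := TopologicalSpace.denseSeq K
  have hs : DenseRange s := TopologicalSpace.denseRange_denseSeq K
  let r : ℕ → ℝ := fun k => 1 / ((k : ℝ) + 1)
  have hr : ∀ k, 0 < r k := fun k => Nat.one_div_pos_of_nat
  classical
  -- A dense sequence keeps the local supremum measurable; points outside the ball get the lower
  -- bound `-B`, which cannot raise it.
  let w : ℕ → ℕ → X → ℝ := fun k i x => if s i ∈ Metric.ball θ₁ (r k) then F x (s i) else -B
  let W : ℕ → X → ℝ := fun k x => ⨆ i, w k i x
  have hwB : ∀ k i x, |w k i x| ≤ B := by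
    intro k i x
    have hB0 : 0 ≤ B := (abs_nonneg _).trans (hB x θ₁)
    by_cases h : s i ∈ Metric.ball θ₁ (r k)
    · simp only [w, if_pos h]; exact hB _ _
    · simp only [w, if_neg h, abs_neg, abs_of_nonneg hB0, le_refl]
  have hbdd : ∀ k x, BddAbove (Set.range fun i => w k i x) := by
    rintro k x
    exact ⟨B, by rintro _ ⟨i, rfl⟩; exact (abs_le.1 (hwB k i x)).2⟩
  have hWm : ∀ k, Measurable (W k) := by
    intro k
    refine Measurable.iSup fun i => ?_
    by_cases h : s i ∈ Metric.ball θ₁ (r k)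
    · simp only [w, if_pos h]; exact hFm _
    · simp only [w, if_neg h]; exact measurable_const
  have hWB : ∀ k x, |W k x| ≤ B := by
    intro k x
    rw [abs_le]
    exact ⟨(abs_le.1 (hwB k 0 x)).1.trans (le_ciSup (hbdd k x) 0),
      ciSup_le fun i => (abs_le.1 (hwB k i x)).2⟩
  have hdom : ∀ k x, ∀ θ ∈ Metric.ball θ₁ (r k), F x θ ≤ W k x := by
    intro k x θ hθ
    have hclosed : IsClosed {θ | F x θ ≤ W k x} := isClosed_le (hFc x) continuous_const
    have hsub : Metric.ball θ₁ (r k) ⊆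
        closure (Metric.ball θ₁ (r k) ∩ Set.range s) :=
      hs.open_subset_closure_inter Metric.isOpen_ball
    refine closure_minimal ?_ hclosed (hsub hθ)
    rintro _ ⟨hi, i, rfl⟩
    have := le_ciSup (hbdd k x) i
    simp only [w, if_pos hi] at this
    exact this
  have hlim : Tendsto (fun k => ∫ x, W k x ∂μ) atTop (𝓝 (∫ x, F x θ₁ ∂μ)) := by
    refine tendsto_integral_of_dominated_convergence (fun _ => B)
      (fun k => (hWm k).aestronglyMeasurable) (integrable_const _)
      (fun k => Eventually.of_forall fun x => hWB k x) (Eventually.of_forall fun x => ?_)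
    rw [Metric.tendsto_atTop]
    intro ε hε
    obtain ⟨δ, hδ, hδF⟩ := Metric.continuous_iff.1 (hFc x) θ₁ (ε / 2) (half_pos hε)
    obtain ⟨N, hN⟩ := exists_nat_one_div_lt hδ
    refine ⟨N, fun k hk => ?_⟩
    have hrk : r k < δ := (one_div_le_one_div_of_le (by positivity)
      (by have : (N : ℝ) ≤ k := by exact_mod_cast hk
          linarith)).trans_lt hN
    have h1 := hdom k x θ₁ (Metric.mem_ball_self (hr k))
    have h2 : W k x ≤ F x θ₁ + ε / 2 := by
      refine ciSup_le fun i => ?_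
      by_cases h : s i ∈ Metric.ball θ₁ (r k)
      · simp only [w, if_pos h]
        have := hδF (s i) ((Metric.mem_ball.1 h).trans hrk)
        rw [Real.dist_eq, abs_lt] at this
        linarith
      · simp only [w, if_neg h]
        have := (abs_le.1 (hB x θ₁)).1
        linarith
    rw [Real.dist_eq, abs_lt]
    constructor <;> linarith
  obtain ⟨k, hk⟩ := (hlim.eventually_lt_const hc).exists
  refine ⟨Metric.ball θ₁ (r k), Metric.isOpen_ball, Metric.mem_ball_self (hr k), W k, hWm k, ?_,
    hdom k, hk⟩
  exact Integrable.of_bound (hWm k).aestronglyMeasurable B (Eventually.of_forall fun x => hWB k x)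

/-- Wald's argument: along almost every orbit, each parameter `θ₁ ≠ θ₀` has a neighbourhood on
which the criterion is eventually bounded away from its value at `θ₀`. -/
lemma ae_exists_nhds_eventually_birkhoffSum_add_le {T : X → X} (hT : Ergodic T μ)
    {F : X → K → ℝ} (hFm : ∀ θ, Measurable fun x => F x θ) (hFc : ∀ x, Continuous (F x))
    {B : ℝ} (hB : ∀ᵐ x ∂μ, ∀ θ, F x θ ≤ B) {θ₀ : K} (h₀ : Integrable (fun x => F x θ₀) μ)
    (hlt : ∀ θ, θ ≠ θ₀ → ∃ n : ℕ, ∫ x, max (F x θ) (-(n : ℝ)) ∂μ < ∫ x, F x θ₀ ∂μ) :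
    ∀ᵐ x ∂μ, ∀ θ₁, θ₁ ≠ θ₀ → ∃ V ∈ 𝓝 θ₁, ∃ δ : ℝ, 0 < δ ∧ ∀ᶠ n : ℕ in atTop, ∀ θ ∈ V,
      (n : ℝ)⁻¹ * birkhoffSum T (fun x => F x θ) n x + δ ≤
        (n : ℝ)⁻¹ * birkhoffSum T (fun x => F x θ₀) n x := by
  have hloc : ∀ θ₁, θ₁ ≠ θ₀ → ∃ V : Set K, IsOpen V ∧ θ₁ ∈ V ∧ ∃ W : X → ℝ, Measurable W ∧
      Integrable W μ ∧ (∀ᵐ x ∂μ, ∀ θ ∈ V, F x θ ≤ W x) ∧ ∫ x, W x ∂μ < ∫ x, F x θ₀ ∂μ := by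
    intro θ₁ hθ₁
    obtain ⟨n, hn⟩ := hlt θ₁ hθ₁
    have hn0 : (0 : ℝ) ≤ n := Nat.cast_nonneg n
    have hint : ∫ x, max (min (F x θ₁) B) (-(n : ℝ)) ∂μ = ∫ x, max (F x θ₁) (-(n : ℝ)) ∂μ := by
      refine integral_congr_ae ?_
      filter_upwards [hB] with x hx
      rw [min_eq_left (hx θ₁)]
    -- The upper bound `B` holds only almost everywhere; cutting at `B` as well as at `-n` gives a
    -- function bounded everywhere.
    obtain ⟨V, hV, hθV, W, hW, hWi, hdom, hWlt⟩ := exists_nhds_integral_lt (μ := μ)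
      (F := fun x θ => max (min (F x θ) B) (-(n : ℝ)))
      (fun θ => ((hFm θ).min measurable_const).max measurable_const)
      (fun x => ((hFc x).min continuous_const).max continuous_const)
      (B := |B| + n) (fun x θ => by
        have h1 := le_abs_self B
        have h2 := abs_nonneg B
        rw [abs_le]
        exact ⟨le_trans (by linarith) (le_max_right _ _),
          max_le ((min_le_right _ _).trans (by linarith)) (by linarith)⟩)
      θ₁ (hint.trans_lt hn)
    refine ⟨V, hV, hθV, W, hW, hWi, ?_, hWlt⟩
    filter_upwards [hB] with x hx θ hθ
    have := hdom x θ hθ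
    simp only [min_eq_left (hx θ)] at this
    exact (le_max_left _ _).trans this
  choose! V hVo hVm W hWm hWi hdom hWlt using hloc
  -- A countable subcover of the complement of `θ₀` lets one null set serve all `θ₁`.
  obtain ⟨t, hts, htc, hcover⟩ := TopologicalSpace.countable_cover_nhdsWithin
    (s := {θ : K | θ ≠ θ₀}) (f := V)
    (fun θ hθ => mem_nhdsWithin_of_mem_nhds ((hVo θ hθ).mem_nhds (hVm θ hθ)))
  have hall : ∀ᵐ x ∂μ, ∀ τ ∈ t, (∀ k : ℕ, ∀ θ ∈ V τ, F (T^[k] x) θ ≤ W τ (T^[k] x)) ∧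
      Tendsto (fun n : ℕ => (n : ℝ)⁻¹ * birkhoffSum T (W τ) n x) atTop (𝓝 (∫ x, W τ x ∂μ)) := by
    rw [ae_ball_iff htc]
    intro τ hτ
    have h1 : ∀ k : ℕ, ∀ᵐ x ∂μ, ∀ θ ∈ V τ, F (T^[k] x) θ ≤ W τ (T^[k] x) := fun k =>
      (hT.toMeasurePreserving.iterate k).quasiMeasurePreserving.ae (hdom τ (hts hτ))
    filter_upwards [ae_all_iff.2 h1,
      ae_tendsto_birkhoffAverage hT (hWm τ (hts hτ)) (hWi τ (hts hτ))] with x hx1 hx2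
    exact ⟨hx1, hx2⟩
  filter_upwards [hall, ae_tendsto_birkhoffAverage hT (hFm θ₀) h₀] with x hx hx₀ θ₁ hθ₁
  obtain ⟨τ, hτ, hmem⟩ := Set.mem_iUnion₂.1 (hcover hθ₁)
  have hgap := hWlt τ (hts hτ)
  refine ⟨V τ, (hVo τ (hts hτ)).mem_nhds hmem, (∫ x, F x θ₀ ∂μ - ∫ x, W τ x ∂μ) / 2,
    by linarith, ?_⟩
  have hev := (hx₀.sub (hx τ hτ).2).eventually_const_lt
    (u := (∫ x, F x θ₀ ∂μ - ∫ x, W τ x ∂μ) / 2) (by linarith)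
  filter_upwards [hev] with n hn θ hθ
  have hle : birkhoffSum T (fun x => F x θ) n x ≤ birkhoffSum T (W τ) n x :=
    Finset.sum_le_sum fun k _ => (hx τ hτ).1 k θ hθ
  have := mul_le_mul_of_nonneg_left hle (inv_nonneg.2 (Nat.cast_nonneg (α := ℝ) n))
  linarith

end Wald

/-! ### Negligibility of initial values and convergence of maximizers. -/

section InitialValues

/-- Stability of the criterion under perturbation of the conditional mean and scale. -/
lemma abs_ell_sub_ell_le {E K : Type*} {g σ : E → K → ℝ} {c e v : ℝ} {Y Y' : E} {θ : K}
    (hc : 0 < c) (hσ : c ≤ σ Y θ) (hσ' : 0 < σ Y' θ) (hec : e ≤ 3 / 4 * c ^ 2)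
    (he : |g Y' θ - g Y θ| + |σ Y' θ ^ 2 - σ Y θ ^ 2| ≤ e) :
    |ell g σ v Y' θ - ell g σ v Y θ| ≤
      (2 / c ^ 2 + 2 / c + 2 / c ^ 3) * (e * (1 + |v - g Y θ|)) := by
  rw [ell_eq, ell_eq]
  set s := σ Y θ
  set s' := σ Y' θ
  set a := g Y θ
  set a' := g Y' θ
  have hs : 0 < s := hc.trans_le hσ
  have hg1 : |a' - a| ≤ e := by linarith [abs_nonneg (s' ^ 2 - s ^ 2)]
  have hs1 : |s' ^ 2 - s ^ 2| ≤ e := by linarith [abs_nonneg (a' - a)]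
  have he0 : 0 ≤ e := (abs_nonneg _).trans hg1
  -- The bound `e ≤ 3 / 4 * c ^ 2` leaves `s' ^ 2 ≥ c ^ 2 / 4`.
  have hs'c : c / 2 ≤ s' := by
    have := (abs_le.1 hs1).1
    nlinarith
  have hdiff : |s' - s| ≤ e / c := by
    rw [le_div_iff₀ hc]
    have h1 : |s' ^ 2 - s ^ 2| = |s' - s| * (s' + s) := by
      rw [← abs_of_pos (add_pos hσ' hs), ← abs_mul]; ring_nf
    rw [h1] at hs1
    nlinarith [abs_nonneg (s' - s)]
  have hlog : |Real.log s' - Real.log s| ≤ 2 / c ^ 2 * e := by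
    have h1 := Real.log_le_sub_one_of_pos (div_pos hσ' hs)
    have h2 := Real.log_le_sub_one_of_pos (div_pos hs hσ')
    rw [Real.log_div hσ'.ne' hs.ne'] at h1
    rw [Real.log_div hs.ne' hσ'.ne'] at h2
    have h3 : s' / s - 1 ≤ 2 / c ^ 2 * e := by
      rw [div_sub_one hs.ne', div_le_iff₀ hs]
      calc s' - s ≤ e / c := (le_abs_self _).trans hdiff
        _ = 1 / c ^ 2 * e * c := by field_simp
        _ ≤ 2 / c ^ 2 * e * s := by gcongr; norm_num
    have h4 : s / s' - 1 ≤ 2 / c ^ 2 * e := by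
      rw [div_sub_one hσ'.ne', div_le_iff₀ hσ']
      calc s - s' ≤ e / c := by rw [abs_sub_comm] at hdiff; exact (le_abs_self _).trans hdiff
        _ = 2 / c ^ 2 * e * (c / 2) := by field_simp
        _ ≤ 2 / c ^ 2 * e * s' := by gcongr
    rw [abs_le]; constructor <;> linarith
  have hquot : |(v - a') / s' - (v - a) / s| ≤ 2 / c * e + 2 / c ^ 3 * e * |v - a| := by
    have h1 : (v - a') / s' - (v - a) / s = (a - a') / s' + (v - a) * ((s - s') / (s * s')) := by
      field_simp; ring
    have h2 : |(a - a') / s'| ≤ 2 / c * e := by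
      rw [abs_div, abs_of_pos hσ', div_le_iff₀ hσ']
      calc |a - a'| ≤ e := by rw [abs_sub_comm]; exact hg1
        _ = 2 / c * e * (c / 2) := by field_simp
        _ ≤ 2 / c * e * s' := by gcongr
    have h3 : |(s - s') / (s * s')| ≤ 2 / c ^ 3 * e := by
      rw [abs_div, abs_of_pos (mul_pos hs hσ'), div_le_iff₀ (mul_pos hs hσ')]
      calc |s - s'| ≤ e / c := by rw [abs_sub_comm]; exact hdiff
        _ = 2 / c ^ 3 * e * (c * (c / 2)) := by field_simp
        _ ≤ 2 / c ^ 3 * e * (s * s') := by gcongr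
    rw [h1]
    refine (abs_add_le _ _).trans (add_le_add h2 ?_)
    rw [abs_mul, mul_comm]
    exact mul_le_mul_of_nonneg_right h3 (abs_nonneg _)
  have hphi := (abs_negLogPDF_sub_le ((v - a') / s') ((v - a) / s)).trans hquot
  have htri : |-Real.log s' - negLogPDF ((v - a') / s') -
      (-Real.log s - negLogPDF ((v - a) / s))| ≤ |Real.log s' - Real.log s| +
        |negLogPDF ((v - a') / s') - negLogPDF ((v - a) / s)| := by
    rw [← abs_neg (Real.log s' - Real.log s),
      ← abs_neg (negLogPDF ((v - a') / s') - negLogPDF ((v - a) / s))]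
    refine le_trans (le_of_eq ?_) (abs_add_le _ _)
    ring_nf
  have hw := abs_nonneg (v - a)
  have e1 : 0 ≤ 2 / c ^ 2 * e * |v - a| := by positivity
  have e2 : 0 ≤ 2 / c * e * |v - a| := by positivity
  have e3 : 0 ≤ 2 / c ^ 3 * e := by positivity
  linarith

/-- Geometric weights annihilate a stationary sequence with a finite fractional moment, uniformly
over a parameter. -/
lemma ae_eventually_pow_mul_le {X K : Type*} [MeasurableSpace X] {μ : Measure X} {T : X → X}
    (hT : MeasurePreserving T μ μ) {Φ : X → ENNReal} (hΦ : Measurable Φ)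
    (hfin : ∫⁻ x, Φ x ∂μ < ⊤) {ι ρ : ℝ} (hι : 0 < ι) (hρ0 : 0 < ρ) (hρ1 : ρ < 1)
    {q : X → K → ℝ} (hq : ∀ x θ, ENNReal.ofReal (|q x θ| ^ ι) ≤ Φ x) :
    ∀ᵐ x ∂μ, ∀ ε : ℝ, 0 < ε → ∀ᶠ k : ℕ in atTop, ∀ θ, ρ ^ k * |q (T^[k] x) θ| ≤ ε := by
  set r := ρ ^ ι with hr
  have hr0 : 0 < r := Real.rpow_pos_of_pos hρ0 ι
  have hr1 : r < 1 := Real.rpow_lt_one hρ0.le hρ1 hι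
  have hΦk : ∀ k : ℕ, Measurable fun x => Φ (T^[k] x) := fun k =>
    hΦ.comp (hT.measurable.iterate k)
  have hterm : ∀ k : ℕ, ∫⁻ x, ENNReal.ofReal (r ^ k) * Φ (T^[k] x) ∂μ =
      ENNReal.ofReal (r ^ k) * ∫⁻ x, Φ x ∂μ := by
    intro k
    rw [lintegral_const_mul _ (hΦk k),
      (hT.iterate k).lintegral_comp hΦ]
  -- By stationarity the weighted series of `Φ ∘ T^[k]` has a finite mean, so it converges almost
  -- everywhere and its terms vanish; taking `ι`-th roots turns `r = ρ ^ ι` back into `ρ`.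
  have hsum : ∫⁻ x, ∑' k : ℕ, ENNReal.ofReal (r ^ k) * Φ (T^[k] x) ∂μ ≠ ⊤ := by
    rw [lintegral_tsum fun k => ((hΦk k).const_mul _).aemeasurable]
    simp only [hterm]
    rw [ENNReal.tsum_mul_right]
    refine ENNReal.mul_ne_top ?_ hfin.ne
    rw [← ENNReal.ofReal_tsum_of_nonneg (fun k => by positivity)
      (summable_geometric_of_lt_one hr0.le hr1)]
    exact ENNReal.ofReal_ne_top
  have hae := ae_lt_top (Measurable.tsum fun k => (hΦk k).const_mul (ENNReal.ofReal (r ^ k))) hsum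
  filter_upwards [hae] with x hx ε hε
  have hlim := ENNReal.tendsto_atTop_zero_of_tsum_ne_top hx.ne
  have hεpos : (0 : ENNReal) < ENNReal.ofReal (ε ^ ι) :=
    ENNReal.ofReal_pos.2 (Real.rpow_pos_of_pos hε ι)
  filter_upwards [hlim.eventually_lt_const hεpos] with k hk θ
  have h1 : ENNReal.ofReal ((ρ ^ k * |q (T^[k] x) θ|) ^ ι) ≤ ENNReal.ofReal (ε ^ ι) := by
    refine le_trans ?_ hk.le
    rw [Real.mul_rpow (by positivity) (abs_nonneg _), ← Real.rpow_natCast_mul hρ0.le,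
      mul_comm (k : ℝ) ι, Real.rpow_mul_natCast hρ0.le, ENNReal.ofReal_mul (by positivity)]
    gcongr
    exact hq _ θ
  rw [ENNReal.ofReal_le_ofReal_iff (by positivity)] at h1
  exact (Real.rpow_le_rpow_iff (by positivity) hε.le hι).1 h1

/-- The averages of two uniformly asymptotically equivalent sequences of continuous functions on
a compact space are uniformly asymptotically equivalent. -/
lemma exists_tendsto_zero_abs_average_sub_le {K : Type*} [TopologicalSpace K] [CompactSpace K]
    [Nonempty K] {a b : ℕ → K → ℝ} (ha : ∀ k, Continuous (a k)) (hb : ∀ k, Continuous (b k))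
    (hab : ∀ ε : ℝ, 0 < ε → ∀ᶠ k in atTop, ∀ θ, |b k θ - a k θ| ≤ ε) :
    ∃ r : ℕ → ℝ, Tendsto r atTop (𝓝 0) ∧ ∀ (n : ℕ) (θ : K),
      |(n : ℝ)⁻¹ * ∑ k ∈ Finset.range n, b k θ - (n : ℝ)⁻¹ * ∑ k ∈ Finset.range n, a k θ| ≤
        r n := by
  let δ : ℕ → ℝ := fun k => ⨆ θ, |b k θ - a k θ|
  have hbdd : ∀ k, BddAbove (Set.range fun θ => |b k θ - a k θ|) := fun k =>
    (isCompact_range ((hb k).sub (ha k)).abs).bddAbove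
  have hδ : Tendsto δ atTop (𝓝 0) := by
    rw [Metric.tendsto_atTop']
    intro ε hε
    obtain ⟨N, hN⟩ := eventually_atTop.1 (hab (ε / 2) (half_pos hε))
    refine ⟨N, fun k hk => ?_⟩
    have h1 : δ k ≤ ε / 2 := ciSup_le fun θ => hN k hk.le θ
    have h2 : 0 ≤ δ k := Real.iSup_nonneg fun θ => abs_nonneg _
    rw [Real.dist_eq, sub_zero, abs_of_nonneg h2]
    linarith
  refine ⟨_, hδ.cesaro, fun n θ => ?_⟩
  rw [← mul_sub, ← Finset.sum_sub_distrib, abs_mul, abs_of_nonneg (by positivity)]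
  refine mul_le_mul_of_nonneg_left ?_ (by positivity)
  exact (Finset.abs_sum_le_sum_abs _ _).trans
    (Finset.sum_le_sum fun k _ => le_ciSup (hbdd k) θ)

/-- Maximizers of a perturbed criterion converge if the criterion separates `θ₀` from every
other point. -/
lemma tendsto_of_isMaxOn {K : Type*} [TopologicalSpace K] [CompactSpace K]
    {a b : ℕ → K → ℝ} {θ₀ : K} {r : ℕ → ℝ} (hr : Tendsto r atTop (𝓝 0))
    (hab : ∀ n θ, |b n θ - a n θ| ≤ r n)
    (hsep : ∀ θ₁, θ₁ ≠ θ₀ → ∃ V ∈ 𝓝 θ₁, ∃ δ : ℝ, 0 < δ ∧ ∀ᶠ n : ℕ in atTop, ∀ θ ∈ V,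
      a n θ + δ ≤ a n θ₀)
    {τ : ℕ → K} (hτ : ∀ᶠ n in atTop, b n θ₀ ≤ b n (τ n)) :
    Tendsto τ atTop (𝓝 θ₀) := by
  -- In a compact space it is enough that no `θ₁ ≠ θ₀` is a cluster point: there the gap `δ` would
  -- beat two errors smaller than `δ / 2`.
  refine isCompact_univ.tendsto_nhds_of_unique_mapClusterPt (Eventually.of_forall fun _ => trivial)
    fun θ₁ _ hcl => ?_
  by_contra hne
  obtain ⟨V, hV, δ, hδ, hev⟩ := hsep θ₁ hne
  have hfreq := mapClusterPt_iff_frequently.1 hcl V hV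
  obtain ⟨n, hn, h1, h2, h3⟩ :=
    (hfreq.and_eventually (hev.and (hτ.and (hr.eventually_lt_const (half_pos hδ))))).exists
  have h4 := h1 _ hn
  have h5 := (abs_le.1 (hab n (τ n))).2
  have h6 := (abs_le.1 (hab n θ₀)).1
  linarith

end InitialValues

/-! ### Shifts and lag vectors on path space. -/

section Paths

lemma shift_iterate_apply (x : ℤ → ℝ) (k : ℕ) (t : ℤ) : shift^[k] x t = x (t + k) := by
  induction k generalizing x t with
  | zero => simp
  | succ k ih =>
    rw [Function.iterate_succ_apply, ih, shift]
    congr 1; push_cast; ring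

lemma lagVector_shift_iterate (m : ℕ∞) (x : ℤ → ℝ) (k : ℕ) :
    lagVector m (shift^[k] x) 0 = lagVector m x k := by
  funext j
  simp only [lagVector, shift_iterate_apply]
  congr 1; ring

lemma measurable_lagVector (m : ℕ∞) (t : ℤ) : Measurable fun x : ℤ → ℝ => lagVector m x t :=
  measurable_pi_iff.2 fun _ => measurable_pi_apply _

lemma measurable_pastSigma_lagVector {Ω : Type*} (m : ℕ∞) (y : ℤ → Ω → ℝ) (t : ℤ) :
    Measurable[pastSigma y t] fun ω => lagVector m (fun s => y s ω) t := by
  rw [@measurable_pi_iff]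
  intro j
  have h : t - (j.1 : ℤ) ≤ t := by omega
  exact Measurable.mono (comap_measurable (y (t - (j.1 : ℤ))))
    (le_iSup (fun i : {i : ℤ // i ≤ t} => MeasurableSpace.comap (y i.1) inferInstance) ⟨_, h⟩)
    le_rfl

/-- With `t = k + 1`, term `k` pairs the observation at time `k + 1` with lags starting at time `k`,
as read off the `k`-th shift of a path at times `1` and `0`. -/
lemma quasiLogLik_eq_sum_range {K : Type*} (m : ℕ∞) (g σ : (Lag m → ℝ) → K → ℝ) (y : ℤ → ℝ)
    (y0 : ℕ → ℝ) (n : ℕ) (θ : K) :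
    quasiLogLik m g σ y y0 n θ =
      ∑ k ∈ Finset.range n, ell g σ (y (k + 1)) (lagVector m (observedPath y y0) k) θ := by
  rw [quasiLogLik]
  induction n with
  | zero => simp
  | succ n ih =>
    rw [Finset.sum_Icc_succ_top (by omega), Finset.sum_range_succ, ih]
    push_cast
    rw [add_sub_cancel_right]

end Paths

/-! ### Moments of the innovation and of the log scale. -/

section Innovations

variable {Ω : Type*} [MeasurableSpace Ω] {P : Measure Ω}

lemma measurable_h : Measurable h := measurable_id.mul measurable_score

/-- `ψ(X) = 1` forces `h(X)` to be integrable. -/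
lemma integrable_h_of_psi_eq_one {X : Ω → ℝ} (hψ : psi P X = 1) :
    Integrable (fun ω => h (X ω)) P := by
  by_contra hcon
  rw [psi, integral_undef hcon] at hψ
  exact zero_ne_one hψ

lemma integrable_of_psi_eq_one [IsFiniteMeasure P] {X : Ω → ℝ} (hX : Measurable X)
    (hψ : psi P X = 1) : Integrable X P := by
  refine ((integrable_h_of_psi_eq_one hψ).add (integrable_const 2)).mono'
    hX.aestronglyMeasurable (Eventually.of_forall fun ω => ?_)
  exact abs_le_h_add_two (X ω)

lemma integrable_score [IsFiniteMeasure P] {X : Ω → ℝ} (hX : Measurable X) :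
    Integrable (fun ω => score (X ω)) P :=
  Integrable.of_bound (measurable_score.comp hX).aestronglyMeasurable 1
    (Eventually.of_forall fun ω => abs_score_le_one (X ω))

lemma integral_score_eq_zero {X : Ω → ℝ} (hsymm : IdentDistrib X (fun ω => -X ω) P P) :
    ∫ ω, score (X ω) ∂P = 0 := by
  have h1 := (hsymm.comp measurable_score).integral_eq
  simp only [Function.comp_def, score_neg, integral_neg] at h1
  linarith

lemma integrable_negLogPDF [IsFiniteMeasure P] {X : Ω → ℝ} (hX : Measurable X)
    (hi : Integrable X P) : Integrable (fun ω => negLogPDF (X ω)) P := by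
  refine (hi.abs.add (integrable_const (negLogPDF 0))).mono'
    (measurable_negLogPDF.comp hX).aestronglyMeasurable (Eventually.of_forall fun ω => ?_)
  have h1 := negLogPDF_sub_le (X ω) 0
  rw [sub_zero] at h1
  rw [Real.norm_eq_abs, abs_of_nonneg (negLogPDF_nonneg _)]
  simp only [Pi.add_apply]
  linarith

/-- From above `log s ≤ s ^ ι / ι`; from below `log c ≤ log s`. -/
lemma integrable_log_of_lintegral_rpow_lt_top [IsFiniteMeasure P] {S : Ω → ℝ} (hS : Measurable S)
    {c ι : ℝ} (hc : 0 < c) (hι : 0 < ι) (hcS : ∀ᵐ ω ∂P, c ≤ S ω)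
    (hfin : ∫⁻ ω, ENNReal.ofReal (S ω ^ ι) ∂P < ⊤) :
    Integrable (fun ω => Real.log (S ω)) P := by
  have hpow : Integrable (fun ω => S ω ^ ι) P := by
    refine (lintegral_ofReal_ne_top_iff_integrable
      (hS.pow_const ι).aestronglyMeasurable ?_).1 hfin.ne
    filter_upwards [hcS] with ω hω
    exact Real.rpow_nonneg (hc.le.trans hω) ι
  refine ((hpow.div_const ι).add (integrable_const |Real.log c|)).mono'
    (Real.measurable_log.comp hS).aestronglyMeasurable ?_
  filter_upwards [hcS] with ω hω
  have h0 : 0 < S ω := hc.trans_le hω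
  have h1 := Real.log_le_rpow_div h0.le hι
  have h2 := Real.log_le_log hc hω
  have h3 := neg_abs_le (Real.log c)
  have h4 : 0 ≤ S ω ^ ι / ι := by positivity
  have h5 := abs_nonneg (Real.log c)
  simp only [Pi.add_apply]
  rw [Real.norm_eq_abs, abs_le]
  constructor <;> linarith

end Innovations

/-! ### Mean of the criterion at and away from the true parameter. -/

section Criterion

variable {Ω : Type*} [MeasurableSpace Ω] {P : Measure Ω}
  {E K : Type*} [MeasurableSpace E] {g σ : E → K → ℝ} {Y : Ω → E} {e v : Ω → ℝ} {θ₀ θ : K}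

/-- The criterion has a finite mean at the true parameter. -/
lemma integrable_ell_true [IsFiniteMeasure P] (hY : Measurable Y) (he : Measurable e)
    (hσm : Measurable fun z => σ z θ₀) (hσpos : ∀ z, 0 < σ z θ₀)
    (hv : ∀ᵐ ω ∂P, v ω = g (Y ω) θ₀ + σ (Y ω) θ₀ * e ω) (hψ : psi P e = 1)
    {c ι : ℝ} (hc : 0 < c) (hcσ : ∀ᵐ ω ∂P, c < σ (Y ω) θ₀) (hι : 0 < ι)
    (hfin : ∫⁻ ω, ENNReal.ofReal (σ (Y ω) θ₀ ^ ι) ∂P < ⊤) :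
    Integrable (fun ω => ell g σ (v ω) (Y ω) θ₀) P := by
  have h1 := integrable_log_of_lintegral_rpow_lt_top (hσm.comp hY) hc hι
    (hcσ.mono fun _ h => h.le) hfin
  have h2 := integrable_negLogPDF he (integrable_of_psi_eq_one he hψ)
  refine (h1.neg.sub h2).congr ?_
  filter_upwards [hv] with ω hω
  rw [ell_eq, hω, add_sub_cancel_left, mul_div_cancel_left₀ _ (hσpos _).ne']
  rfl

/-- The truncated criterion has a smaller mean at a parameter that is not equivalent to the true
one. -/
lemma exists_integral_max_ell_lt [IsProbabilityMeasure P] (hY : Measurable Y) (he : Measurable e)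
    (hvm : Measurable v) (hgm : ∀ θ, Measurable fun z => g z θ)
    (hσm : ∀ θ, Measurable fun z => σ z θ) (hσpos : ∀ z θ, 0 < σ z θ)
    (hv : ∀ᵐ ω ∂P, v ω = g (Y ω) θ₀ + σ (Y ω) θ₀ * e ω) (hind : IndepFun Y e P)
    (hψ : psi P e = 1) (hsymm : IdentDistrib e (fun ω => -e ω) P P)
    {c : ℝ} (hc : 0 < c) (hcσ : ∀ᵐ ω ∂P, c < σ (Y ω) θ)
    (hi : Integrable (fun ω => ell g σ (v ω) (Y ω) θ₀) P)
    (hne : ¬ ∀ᵐ ω ∂P, (g (Y ω) θ, σ (Y ω) θ) = (g (Y ω) θ₀, σ (Y ω) θ₀)) :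
    ∃ n : ℕ, ∫ ω, max (ell g σ (v ω) (Y ω) θ) (-(n : ℝ)) ∂P <
      ∫ ω, ell g σ (v ω) (Y ω) θ₀ ∂P := by
  have hum : Measurable fun z => σ z θ₀ / σ z θ - 1 := ((hσm θ₀).div (hσm θ)).sub_const 1
  have hbm : Measurable fun z => (g z θ - g z θ₀) / σ z θ :=
    ((hgm θ).sub (hgm θ₀)).div (hσm θ)
  have hAm : Measurable fun ω => ell g σ (v ω) (Y ω) θ := by
    simp only [ell_eq]
    exact (Real.measurable_log.comp ((hσm θ).comp hY)).neg.sub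
      (measurable_negLogPDF.comp ((hvm.sub ((hgm θ).comp hY)).div ((hσm θ).comp hY)))
  have hXm : Measurable fun x => 1 - h x := measurable_h.const_sub 1
  have hX : Integrable (fun ω => 1 - h (e ω)) P :=
    (integrable_const 1).sub (integrable_h_of_psi_eq_one hψ)
  have hX0 : ∫ ω, (1 - h (e ω)) ∂P = 0 := by
    rw [integral_sub (integrable_const 1) (integrable_h_of_psi_eq_one hψ)]
    rw [psi] at hψ
    simp [hψ]
  refine exists_integral_max_lt (u := fun ω => σ (Y ω) θ₀ / σ (Y ω) θ - 1)
    (b := fun ω => (g (Y ω) θ - g (Y ω) θ₀) / σ (Y ω) θ) (X := fun ω => 1 - h (e ω))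
    (Z := fun ω => score (e ω)) (B := -Real.log c) hAm hi
    (hcσ.mono fun ω hω => ell_le hc hω.le _) (hum.comp hY) (hbm.comp hY) hX (integrable_score he)
    hX0 (integral_score_eq_zero hsymm) (hind.comp (hum.prodMk hbm) hXm)
    (hind.comp (hum.prodMk hbm) measurable_score) ?_ ?_
  · filter_upwards [hv] with ω hω
    rw [hω]
    exact ell_sub_ell_le (hσpos _ _) (hσpos _ _) _
  · intro hcon
    refine hne ?_
    filter_upwards [hcon, hv] with ω h1 h2
    by_contra h3
    rw [h2] at h1
    exact (ell_sub_ell_lt (hσpos _ _) (hσpos _ _) _ h3).ne h1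

/-- A supremum of continuous functions on a separable space has a measurable version. -/
lemma exists_measurable_dominating [TopologicalSpace K] [TopologicalSpace.SeparableSpace K]
    {Φ : E → K → ENNReal} (hm : ∀ θ, Measurable fun z => Φ z θ) (hc : ∀ z, Continuous (Φ z)) :
    ∃ Ψ : E → ENNReal, Measurable Ψ ∧ (∀ z θ, Φ z θ ≤ Ψ z) ∧ ∀ z, Ψ z ≤ ⨆ θ, Φ z θ := by
  rcases isEmpty_or_nonempty K with hK | hK
  · exact ⟨0, measurable_const, fun _ θ => hK.elim θ, fun _ => zero_le⟩
  · refine ⟨fun z => ⨆ i, Φ z (TopologicalSpace.denseSeq K i), Measurable.iSup fun i => hm _,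
      fun z θ => ?_, fun z => iSup_le fun i => le_iSup (Φ z) _⟩
    have hcl : IsClosed {θ | Φ z θ ≤ ⨆ i, Φ z (TopologicalSpace.denseSeq K i)} :=
      isClosed_le (hc z) continuous_const
    refine closure_minimal ?_ hcl (TopologicalSpace.denseRange_denseSeq K θ)
    rintro _ ⟨i, rfl⟩
    exact le_iSup (fun i => Φ z (TopologicalSpace.denseSeq K i)) i

end Criterion

/-! ### Pathwise comparison of the two criteria. -/

section Approximation

/-- An exponentially decaying error in the conditional mean and scale has an asymptotically
negligible effect on the criterion. -/
lemma eventually_abs_ell_sub_ell_le {E K : Type*} {g σ : E → K → ℝ} {Y Y' : ℕ → E} {v e : ℕ → ℝ}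
    {θ₀ : K} {c C ρ : ℝ} (hc : 0 < c) (hC : 0 ≤ C) (hρ0 : 0 < ρ) (hρ1 : ρ < 1)
    (hσpos : ∀ z θ, 0 < σ z θ) (hσ : ∀ k θ, c ≤ σ (Y k) θ)
    (hv : ∀ k, v k = g (Y k) θ₀ + σ (Y k) θ₀ * e k)
    (hinit : ∀ k θ, |g (Y' k) θ - g (Y k) θ| + |σ (Y' k) θ ^ 2 - σ (Y k) θ ^ 2| ≤ C * ρ ^ (k + 1))
    (hgs : ∀ ε : ℝ, 0 < ε → ∀ᶠ k : ℕ in atTop, ∀ θ, ρ ^ k * |g (Y k) θ| ≤ ε)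
    (hσs : ∀ ε : ℝ, 0 < ε → ∀ᶠ k : ℕ in atTop, √ρ ^ k * |σ (Y k) θ₀| ≤ ε)
    (hes : ∀ ε : ℝ, 0 < ε → ∀ᶠ k : ℕ in atTop, √ρ ^ k * |e k| ≤ ε) {ε : ℝ} (hε : 0 < ε) :
    ∀ᶠ k in atTop, ∀ θ, |ell g σ (v k) (Y' k) θ - ell g σ (v k) (Y k) θ| ≤ ε := by
  set M : ℝ := (2 / c ^ 2 + 2 / c + 2 / c ^ 3) * C with hM
  have hM0 : 0 ≤ M := by positivity
  -- The factor 4 counts the terms `1`, `|g(θ₀)|`, `σ(θ₀)|e|`, `|g(θ)|`, each at most `η` after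
  -- weighting by `ρ ^ k`; `η ≤ 1` serves the product term.
  set η : ℝ := min 1 (ε / (4 * M + 1)) with hη
  have hη0 : 0 < η := by positivity
  have hη1 : η ≤ 1 := min_le_left _ _
  have hηM : M * (4 * η) ≤ ε := by
    have : η ≤ ε / (4 * M + 1) := min_le_right _ _
    rw [le_div_iff₀ (by positivity)] at this
    nlinarith
  have hpow := tendsto_pow_atTop_nhds_zero_of_lt_one hρ0.le hρ1
  have hsmall : ∀ᶠ k : ℕ in atTop, C * ρ ^ (k + 1) < 3 / 4 * c ^ 2 := by
    have h1 : Tendsto (fun k : ℕ => C * ρ ^ (k + 1)) atTop (𝓝 (C * 0)) :=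
      (hpow.comp (tendsto_add_atTop_nat 1)).const_mul C
    rw [mul_zero] at h1
    exact h1.eventually_lt_const (by positivity)
  filter_upwards [hgs η hη0, hσs η hη0, hes η hη0, hsmall, hpow.eventually_lt_const hη0]
    with k h1 h2 h3 h4 h5 θ
  refine (abs_ell_sub_ell_le hc (hσ k θ) (hσpos _ _) h4.le (hinit k θ)).trans
    (le_trans ?_ hηM)
  -- Each factor of `σ(θ₀)|e|` receives half of the geometric weight, `√ρ ^ k`.
  have hprod : ρ ^ k * (|σ (Y k) θ₀| * |e k|) ≤ η := by
    have hsq : ρ ^ k = √ρ ^ k * √ρ ^ k := by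
      rw [← mul_pow, Real.mul_self_sqrt hρ0.le]
    calc ρ ^ k * (|σ (Y k) θ₀| * |e k|) = (√ρ ^ k * |σ (Y k) θ₀|) * (√ρ ^ k * |e k|) := by
          rw [hsq]; ring
      _ ≤ η * 1 := mul_le_mul h2 (h3.trans hη1) (by positivity) hη0.le
      _ = η := mul_one η
  have habs : |v k - g (Y k) θ| ≤ |g (Y k) θ₀| + |σ (Y k) θ₀| * |e k| + |g (Y k) θ| := by
    rw [hv k, ← abs_mul]
    exact (abs_sub _ _).trans (add_le_add_left (abs_add_le _ _) _)
  have hmain : ρ ^ k * (1 + |v k - g (Y k) θ|) ≤ 4 * η := by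
    have h6 := mul_le_mul_of_nonneg_left habs (pow_pos hρ0 k).le
    have h7 := h1 θ₀
    have h8 := h1 θ
    nlinarith
  have hn : 0 ≤ ρ ^ k * (1 + |v k - g (Y k) θ|) := by positivity
  calc (2 / c ^ 2 + 2 / c + 2 / c ^ 3) * (C * ρ ^ (k + 1) * (1 + |v k - g (Y k) θ|))
      = M * (ρ * (ρ ^ k * (1 + |v k - g (Y k) θ|))) := by rw [hM]; ring
    _ ≤ M * (4 * η) := by
      refine mul_le_mul_of_nonneg_left ?_ hM0
      nlinarith

end Approximation

end LQMLE

/-! ### Strong consistency. -/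

open LQMLE in
theorem theorem1
    {Ω : Type*} [MeasurableSpace Ω] (P : Measure Ω) [IsProbabilityMeasure P]
    -- number of lags (finite or infinite), dimension of the parameter, conditional mean and scale
    (m : ℕ∞) (d : ℕ)
    (g σ : (Lag m → ℝ) → EuclideanSpace ℝ (Fin d) → ℝ)
    (hg : Measurable (Function.uncurry g)) (hσ : Measurable (Function.uncurry σ))
    (hσpos : ∀ Y θ, 0 < σ Y θ)
    -- parameter space and true parameter
    (Θ : Set (EuclideanSpace ℝ (Fin d))) (θ₀ : EuclideanSpace ℝ (Fin d)) (hθ₀ : θ₀ ∈ Θ)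
    -- the process, the innovations, the model equation
    (y η : ℤ → Ω → ℝ) (hy : ∀ t, Measurable (y t)) (hη : ∀ t, Measurable (η t))
    (hmodel : ∀ t : ℤ, ∀ᵐ ω ∂P,
      y t ω = g (lagVector m (fun s => y s ω) (t - 1)) θ₀
        + σ (lagVector m (fun s => y s ω) (t - 1)) θ₀ * η t ω)
    (hηpast : ∀ t : ℤ,
      Indep (MeasurableSpace.comap (η t) inferInstance) (pastSigma y (t - 1)) P)
    -- the initial value for the unobserved past (constant or random)
    (y0 : Ω → ℕ → ℝ)
    -- the parameter space is compact
    (hcompact : IsCompact Θ)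
    -- i.i.d. symmetric innovations with `ψ = 1`
    (hηindep : iIndepFun η P) (hηident : ∀ s t, IdentDistrib (η s) (η t) P P)
    (hηsymm : ∀ t, IdentDistrib (η t) (fun ω => -η t ω) P P)
    (hψ : ∀ t, psi P (η t) = 1)
    -- strict stationarity and ergodicity
    (hergodic : IsStationaryErgodic P y)
    -- lower bound on the scale
    (hlower : ∃ c : ℝ, 0 < c ∧ ∀ θ ∈ Θ, ∀ t : ℤ, ∀ᵐ ω ∂P,
      c < σ (lagVector m (fun s => y s ω) (t - 1)) θ)
    -- continuity in the parameter
    (hgcont : ∀ Y, ContinuousOn (g Y) Θ) (hσcont : ∀ Y, ContinuousOn (σ Y) Θ)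
    -- identifiability
    (hident : ∀ t : ℤ, ∀ θ ∈ Θ,
      (∀ᵐ ω ∂P,
        (g (lagVector m (fun s => y s ω) (t - 1)) θ, σ (lagVector m (fun s => y s ω) (t - 1)) θ)
        = (g (lagVector m (fun s => y s ω) (t - 1)) θ₀,
            σ (lagVector m (fun s => y s ω) (t - 1)) θ₀)) ↔ θ = θ₀)
    -- fractional moments
    (hmoment : ∃ ι : ℝ, 0 < ι ∧ ∀ t : ℤ,
      (∫⁻ ω, ⨆ θ ∈ Θ, ENNReal.ofReal (|g (lagVector m (fun s => y s ω) (t - 1)) θ| ^ ι) ∂P)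
        + (∫⁻ ω, ENNReal.ofReal (σ (lagVector m (fun s => y s ω) (t - 1)) θ₀ ^ ι) ∂P) < ⊤)
    -- exponentially decaying effect of the initial value
    (hinit : ∃ (C : Ω → ℝ) (ρ : ℝ), Measurable[pastSigma y 0] C ∧ (∀ ω, 0 ≤ C ω) ∧
      0 < ρ ∧ ρ < 1 ∧ ∀ t : ℕ, 1 ≤ t → ∀ᵐ ω ∂P, ∀ θ ∈ Θ,
        |g (lagVector m (observedPath (fun s => y s ω) (y0 ω)) ((t : ℤ) - 1)) θ
            - g (lagVector m (fun s => y s ω) ((t : ℤ) - 1)) θ|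
          + |σ (lagVector m (observedPath (fun s => y s ω) (y0 ω)) ((t : ℤ) - 1)) θ ^ 2
            - σ (lagVector m (fun s => y s ω) ((t : ℤ) - 1)) θ ^ 2| ≤ C ω * ρ ^ t)
    -- the estimator: any maximizer of the quasi-likelihood over the parameter space
    (θhat : ℕ → Ω → EuclideanSpace ℝ (Fin d))
    (hθhat : ∀ n : ℕ, 1 ≤ n → ∀ᵐ ω ∂P, θhat n ω ∈ Θ ∧
      IsMaxOn (quasiLogLik m g σ (fun s => y s ω) (y0 ω) n) Θ (θhat n ω)) :
    ∀ᵐ ω ∂P, Tendsto (fun n => θhat n ω) atTop (𝓝 θ₀) := by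
  classical
  obtain ⟨c, hc, hcσ⟩ := hlower
  obtain ⟨ι, hι, hmom⟩ := hmoment
  obtain ⟨C, ρ, -, hC, hρ0, hρ1, hini⟩ := hinit
  have : CompactSpace Θ := isCompact_iff_compactSpace.1 hcompact
  have : Nonempty Θ := ⟨⟨θ₀, hθ₀⟩⟩
  -- the model with the parameter restricted to the parameter space
  let G : (Lag m → ℝ) → Θ → ℝ := fun Y θ => g Y θ
  let S : (Lag m → ℝ) → Θ → ℝ := fun Y θ => σ Y θ
  let τ₀ : Θ := ⟨θ₀, hθ₀⟩
  have hGm : ∀ θ, Measurable fun Y => G Y θ := fun θ =>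
    hg.comp (measurable_id.prodMk measurable_const)
  have hSm : ∀ θ, Measurable fun Y => S Y θ := fun θ =>
    hσ.comp (measurable_id.prodMk measurable_const)
  have hGc : ∀ Y, Continuous (G Y) := fun Y => (hgcont Y).domRestrict
  have hSc : ∀ Y, Continuous (S Y) := fun Y => (hσcont Y).domRestrict
  have hSpos : ∀ Y θ, 0 < S Y θ := fun Y θ => hσpos Y θ
  have hellc : ∀ v Y, Continuous (ell G S v Y) := by
    intro v Y
    have : ell G S v Y = fun θ => -Real.log (S Y θ) - negLogPDF ((v - G Y θ) / S Y θ) :=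
      funext fun θ => ell_eq v Y θ
    rw [this]
    exact ((hSc Y).log fun θ => (hSpos Y θ).ne').neg.sub
      (continuous_negLogPDF.comp ((continuous_const.sub (hGc Y)).div (hSc Y)
        fun θ => (hSpos Y θ).ne'))
  -- the law of the process on path space
  let path : Ω → ℤ → ℝ := fun ω t => y t ω
  have hpath : Measurable path := measurable_pi_iff.2 hy
  set μ : Measure (ℤ → ℝ) := P.map path with hμ
  have : IsProbabilityMeasure μ := Measure.isProbabilityMeasure_map hpath.aemeasurable
  have herg : Ergodic shift μ := hergodic
  let lag : (ℤ → ℝ) → Lag m → ℝ := fun x => lagVector m x 0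
  have hlag : Measurable lag := measurable_lagVector m 0
  have hlagk : ∀ ω (k : ℕ), lag (shift^[k] (path ω)) = lagVector m (fun s => y s ω) k :=
    fun ω k => lagVector_shift_iterate m _ k
  let F : (ℤ → ℝ) → Θ → ℝ := fun x θ => ell G S (x 1) (lag x) θ
  have hFm : ∀ θ, Measurable fun x => F x θ := by
    intro θ
    simp only [F, ell_eq]
    exact (Real.measurable_log.comp ((hSm θ).comp hlag)).neg.sub (measurable_negLogPDF.comp
      (((measurable_pi_apply 1).sub ((hGm θ).comp hlag)).div ((hSm θ).comp hlag)))
  have hFk : ∀ ω (k : ℕ) θ, F (shift^[k] (path ω)) θ =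
      ell G S (y (k + 1) ω) (lagVector m (fun s => y s ω) k) θ := by
    intro ω k θ
    simp only [F, hlagk, shift_iterate_apply, path]
    rw [add_comm]
  -- one-step versions of the hypotheses
  have hmod : ∀ᵐ ω ∂P, y 1 ω = G (lag (path ω)) τ₀ + S (lag (path ω)) τ₀ * η 1 ω := by
    simpa using hmodel 1
  have hcσ1 : ∀ θ : Θ, ∀ᵐ ω ∂P, c < S (lag (path ω)) θ := fun θ => by
    simpa using hcσ θ θ.2 1
  have hmom1 := hmom 1
  rw [sub_self] at hmom1
  have hmomS : ∫⁻ ω, ENNReal.ofReal (S (lag (path ω)) τ₀ ^ ι) ∂P < ⊤ :=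
    lt_of_le_of_lt le_add_self hmom1
  have hind : IndepFun (lag ∘ path) (η 1) P := by
    have h1 := hηpast 1
    rw [sub_self] at h1
    rw [IndepFun_iff_Indep]
    exact (indep_of_indep_of_le_right h1
      (measurable_iff_comap_le.1 (measurable_pastSigma_lagVector m y 0))).symm
  have hF₀P : Integrable (fun ω => F (path ω) τ₀) P :=
    integrable_ell_true (hlag.comp hpath) (hη 1) (hSm τ₀) (fun z => hSpos z τ₀) hmod (hψ 1) hc
      (hcσ1 τ₀) hι hmomS
  have hF₀ : Integrable (fun x => F x τ₀) μ :=
    (integrable_map_measure (hFm τ₀).aestronglyMeasurable hpath.aemeasurable).2 hF₀P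
  -- The exceptional null set depends on `θ`; a dense sequence and continuity give one null set, at
  -- the price of a weak inequality.
  have hlow : ∀ᵐ x ∂μ, ∀ θ, c ≤ S (lag x) θ := by
    have h1 : ∀ i, ∀ᵐ x ∂μ, c < S (lag x) (TopologicalSpace.denseSeq Θ i) := fun i =>
      (ae_map_iff hpath.aemeasurable
        (measurableSet_lt measurable_const ((hSm _).comp hlag))).2 (hcσ1 _)
    filter_upwards [ae_all_iff.2 h1] with x hx θ
    have hcl : IsClosed {θ | c ≤ S (lag x) θ} := isClosed_le continuous_const (hSc _)
    refine closure_minimal ?_ hcl (TopologicalSpace.denseRange_denseSeq Θ θ)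
    rintro _ ⟨i, rfl⟩
    exact (hx i).le
  have hlt : ∀ θ, θ ≠ τ₀ → ∃ n : ℕ, ∫ x, max (F x θ) (-(n : ℝ)) ∂μ < ∫ x, F x τ₀ ∂μ := by
    intro θ hθ
    obtain ⟨n, hn⟩ := exists_integral_max_ell_lt (θ := θ) (hlag.comp hpath) (hη 1) (hy 1) hGm hSm
      hSpos hmod hind (hψ 1) (hηsymm 1) hc (hcσ1 θ) hF₀P (fun hcon => hθ (Subtype.ext
        ((hident 1 θ θ.2).1 (by simpa using hcon))))
    refine ⟨n, ?_⟩
    rw [hμ, integral_map hpath.aemeasurable ((hFm θ).max measurable_const).aestronglyMeasurable,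
      integral_map hpath.aemeasurable (hFm τ₀).aestronglyMeasurable]
    exact hn
  have hsep := ae_of_ae_map hpath.aemeasurable
    (ae_exists_nhds_eventually_birkhoffSum_add_le herg hFm (fun x => hellc _ _)
      (B := -Real.log c) (hlow.mono fun x hx θ => ell_le hc (hx θ) _) hF₀ hlt)
  -- growth of the stationary sequences
  have hgrowG : ∀ᵐ ω ∂P, ∀ ε : ℝ, 0 < ε → ∀ᶠ k : ℕ in atTop, ∀ θ,
      ρ ^ k * |G (lag (shift^[k] (path ω))) θ| ≤ ε := by
    obtain ⟨Ψ, hΨm, hΨ, hΨle⟩ := exists_measurable_dominating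
      (Φ := fun z (θ : Θ) => ENNReal.ofReal (|G z θ| ^ ι))
      (fun θ => (((hGm θ).abs).pow_const ι).ennreal_ofReal)
      (fun z => ENNReal.continuous_ofReal.comp
        ((hGc z).abs.rpow_const fun θ => Or.inr hι.le))
    have hm : Measurable fun x => Ψ (lag x) := hΨm.comp hlag
    refine ae_of_ae_map hpath.aemeasurable (ae_eventually_pow_mul_le herg.toMeasurePreserving
      hm ?_ hι hρ0 hρ1 fun x θ => hΨ (lag x) θ)
    rw [hμ, lintegral_map hm hpath]
    refine lt_of_le_of_lt (lintegral_mono fun ω => ?_) (lt_of_le_of_lt le_self_add hmom1)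
    refine (hΨle _).trans (iSup_le fun θ => ?_)
    exact le_iSup₂ (f := fun θ (_ : θ ∈ Θ) =>
      ENNReal.ofReal (|g (lagVector m (fun s => y s ω) 0) θ| ^ ι)) θ.1 θ.2
  have hsρ0 : 0 < √ρ := Real.sqrt_pos.2 hρ0
  have hsρ1 : √ρ < 1 := by rw [Real.sqrt_lt' one_pos]; simpa using hρ1
  have hgrowS : ∀ᵐ ω ∂P, ∀ ε : ℝ, 0 < ε → ∀ᶠ k : ℕ in atTop, ∀ _ : Unit,
      √ρ ^ k * |S (lag (shift^[k] (path ω))) τ₀| ≤ ε := by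
    have hm : Measurable fun x => ENNReal.ofReal (S (lag x) τ₀ ^ ι) :=
      (((hSm τ₀).comp hlag).pow_const ι).ennreal_ofReal
    refine ae_of_ae_map hpath.aemeasurable (ae_eventually_pow_mul_le herg.toMeasurePreserving
      (q := fun x (_ : Unit) => S (lag x) τ₀) hm ?_ hι hsρ0 hsρ1 fun x _ => ?_)
    · rw [hμ, lintegral_map hm hpath]; exact hmomS
    · rw [abs_of_pos (hSpos _ _)]
  -- The innovation as a function of the path, so that stationarity of `y` alone controls its
  -- growth; it agrees with `η 1` almost surely.
  let res : (ℤ → ℝ) → ℝ := fun x => (x 1 - G (lag x) τ₀) / S (lag x) τ₀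
  have hresm : Measurable res :=
    ((measurable_pi_apply 1).sub ((hGm τ₀).comp hlag)).div ((hSm τ₀).comp hlag)
  have hgrowE : ∀ᵐ ω ∂P, ∀ ε : ℝ, 0 < ε → ∀ᶠ k : ℕ in atTop, ∀ _ : Unit,
      √ρ ^ k * |res (shift^[k] (path ω))| ≤ ε := by
    have hm : Measurable fun x => ENNReal.ofReal (|res x| ^ (1 : ℝ)) :=
      (hresm.abs.pow_const 1).ennreal_ofReal
    refine ae_of_ae_map hpath.aemeasurable (ae_eventually_pow_mul_le herg.toMeasurePreserving
      (q := fun x (_ : Unit) => res x) hm ?_ one_pos hsρ0 hsρ1 fun x _ => le_rfl)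
    rw [hμ, lintegral_map hm hpath]
    have hint := integrable_of_psi_eq_one (hη 1) (hψ 1)
    refine lt_of_eq_of_lt (lintegral_congr_ae ?_) hint.abs.lintegral_lt_top
    filter_upwards [hmod] with ω hω
    have : res (path ω) = η 1 ω := by
      simp only [res]
      change (y 1 ω - _) / _ = _
      rw [hω, add_sub_cancel_left, mul_div_cancel_left₀ _ (hSpos _ _).ne']
    rw [this, Real.rpow_one]
  have hlowk : ∀ᵐ ω ∂P, ∀ k : ℕ, ∀ θ, c ≤ S (lag (shift^[k] (path ω))) θ :=
    ae_of_ae_map hpath.aemeasurable (ae_all_iff.2 fun k =>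
      (herg.toMeasurePreserving.iterate k).quasiMeasurePreserving.ae hlow)
  have hinik : ∀ᵐ ω ∂P, ∀ k : ℕ, ∀ θ ∈ Θ,
      |g (lagVector m (observedPath (fun s => y s ω) (y0 ω)) k) θ
          - g (lagVector m (fun s => y s ω) k) θ|
        + |σ (lagVector m (observedPath (fun s => y s ω) (y0 ω)) k) θ ^ 2
          - σ (lagVector m (fun s => y s ω) k) θ ^ 2| ≤ C ω * ρ ^ (k + 1) := by
    refine ae_all_iff.2 fun k => ?_
    have := hini (k + 1) (by omega)
    push_cast at this
    simpa only [add_sub_cancel_right] using this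
  have hmax : ∀ᵐ ω ∂P, ∀ n : ℕ, 1 ≤ n → θhat n ω ∈ Θ ∧
      IsMaxOn (quasiLogLik m g σ (fun s => y s ω) (y0 ω) n) Θ (θhat n ω) :=
    ae_all_iff.2 fun n => ae_all_iff.2 (hθhat n)
  filter_upwards [hsep, hgrowG, hgrowS, hgrowE, hlowk, hinik, hmax]
    with ω hsep hgrowG hgrowS hgrowE hlowk hinik hmax
  let a : ℕ → Θ → ℝ := fun k θ => F (shift^[k] (path ω)) θ
  let b : ℕ → Θ → ℝ := fun k θ =>
    ell G S (y (k + 1) ω) (lagVector m (observedPath (fun s => y s ω) (y0 ω)) k) θ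
  have hab : ∀ ε : ℝ, 0 < ε → ∀ᶠ k in atTop, ∀ θ, |b k θ - a k θ| ≤ ε := by
    intro ε hε
    have := eventually_abs_ell_sub_ell_le (g := G) (σ := S) (θ₀ := τ₀)
      (Y := fun k => lag (shift^[k] (path ω)))
      (Y' := fun k => lagVector m (observedPath (fun s => y s ω) (y0 ω)) k)
      (v := fun k => (shift^[k] (path ω)) 1)
      (e := fun k => res (shift^[k] (path ω))) hc (hC ω) hρ0 hρ1 hSpos hlowk
      (fun k => by
        simp only [res]
        rw [mul_div_cancel₀ _ (hSpos _ _).ne']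
        ring)
      (fun k θ => by
        rw [hlagk]
        exact hinik k θ θ.2)
      hgrowG (fun ε hε => (hgrowS ε hε).mono fun k hk => hk ())
      (fun ε hε => (hgrowE ε hε).mono fun k hk => hk ()) hε
    filter_upwards [this] with k hk θ
    have h1 := hk θ
    have h2 : (shift^[k] (path ω)) 1 = y (k + 1) ω := by
      rw [shift_iterate_apply, add_comm]
    rw [h2] at h1
    simp only [a, b, hFk]
    rw [hlagk] at h1
    exact h1
  obtain ⟨r, hr, hrab⟩ := exists_tendsto_zero_abs_average_sub_le
    (fun k => hellc _ _) (fun k => hellc _ _) hab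
  -- The default `τ₀` is harmless: for `n ≥ 1` the estimator lies in `Θ` on the chosen event.
  let τ : ℕ → Θ := fun n => if h : θhat n ω ∈ Θ then ⟨θhat n ω, h⟩ else τ₀
  have hτ : Tendsto τ atTop (𝓝 τ₀) := by
    refine tendsto_of_isMaxOn hr hrab hsep ?_
    filter_upwards [eventually_ge_atTop 1] with n hn
    obtain ⟨hmem, hM⟩ := hmax n hn
    refine mul_le_mul_of_nonneg_left ?_ (by positivity)
    have h1 := isMaxOn_iff.1 hM θ₀ hθ₀
    rw [quasiLogLik_eq_sum_range, quasiLogLik_eq_sum_range] at h1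
    simp only [τ, dif_pos hmem]
    exact h1
  refine ((continuous_subtype_val.tendsto τ₀).comp hτ).congr' ?_
  filter_upwards [eventually_ge_atTop 1] with n hn
  simp only [Function.comp_apply, τ, dif_pos (hmax n hn).1]
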